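/- Let $\kappa$ be a regular (in particular infinite) cardinal and let $\theta<\kappa^+$ be an ordinal. For a $C^*$-algebra $\mathcal A$, a minimal projection is a nonzero projection $p\in\mathcal A$ with $p\mathcal A p=\mathbb C p$, and $\mathcal I^{At}(\mathcal A)$ denotes the norm-closed $*$-subalgebra of $\mathcal A$ generated by the minimal projections of $\mathcal A$. The algebra $\mathcal A$ is called scattered if $\mathcal I^{At}(\mathcal B)\neq\{0\}$ for every nonzero $C^*$-subalgebra $\mathcal B\subseteq\mathcal A$. The Cantor--Bendixson sequence of a scattered $\mathcal A$ is the unique increasing sequence $(\mathcal I_\alpha)_{\alpha\le ht(\mathcal A)}$ of closed two-sided ideals, indexed by ordinals, with $\mathcal I_0=\{0\}$, $\mathcal I_\gamma=\overline{\bigcup_{\alpha<\gamma}\mathcal I_\alpha}$ for limit $\gamma\le ht(\mathcal A)$, $\mathcal I^{At}(\mathcal A/\mathcal I_\alpha)=\{[a]_{\mathcal I_\alpha}: a\in\mathcal I_{\alpha+1}\}$ for $\alpha<ht(\mathcal A)$, and such that $ht(\mathcal A)$, the height of $\mathcal A$, is the least ordinal with $\mathcal I_{ht(\mathcal A)}=\mathcal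 A$. The algebra $\mathcal A$ is fully noncommutative if for each $\alpha<ht(\mathcal A)$ the quotient $\mathcal I_{\alpha+1}/\mathcal I_\alpha$ is $*$-isomorphic to the algebra of all compact operators on some Hilbert space; its width $wd(\mathcal A)$ is the supremum of the cardinals $\mu$ such that, for some $\alpha<ht(\mathcal A)$, $\mathcal I_{\alpha+1}/\mathcal I_\alpha$ is $*$-isomorphic to a nondegenerate $C^*$-subalgebra of the algebra $\mathcal K(\ell_2(\mu))$ of compact operators on $\ell_2(\mu)$. The algebra $\mathcal A$ is stable if $\mathcal A\cong\mathcal A\otimes\mathcal K(\ell_2)$. Then there is a scattered $C^*$-algebra $\mathcal A_\theta$ of height $\theta$, with Cantor--Bendixson sequence $(\mathcal I_\alpha)_{\alpha\le\theta}$, such that $\mathcal I_{\alpha+1}/\mathcal I_\alpha$ is $*$-isomorphic to $\mathcal K(\ell_2(\kappa))$ for every $\alpha<\theta$. In particular $\mathcal A_\theta$ is fully noncommutative and, if $\theta\neq 0$, $wd(\mathcal A_\theta)=\kappa$. Moreover $\mathcal A_\theta$ can be chosen to be stable. -/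

import Mathlib

universe u v w

noncomputable section

namespace ScatteredCStar

open scoped TensorProduct

/-! ### Compact operators on a Hilbert space -/

/-- The adjoint of a compact operator on a Hilbert space is compact. -/
theorem isCompactOperator_adjoint {H : Type u} [NormedAddCommGroup H] [InnerProductSpace ℂ H]
    [CompleteSpace H] {T : H →L[ℂ] H} (hT : IsCompactOperator T) :
    IsCompactOperator (star T : H →L[ℂ] H) := by
  have hTT : IsCompactOperator (T ∘L star T : H →L[ℂ] H) := hT.comp_clm (star T)
  have key : TotallyBounded ((T ∘L star T : H →L[ℂ] H) '' Metric.ball 0 1) :=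
    ((hTT.isCompact_closure_image_ball (f := ((T ∘L star T : H →L[ℂ] H) : H →ₗ[ℂ] H))
      1).totallyBounded).subset subset_closure
  have hineq : ∀ x ∈ Metric.ball (0 : H) 1, ∀ y ∈ Metric.ball (0 : H) 1,
      dist (star T x) (star T y) ^ 2 ≤
        2 * dist ((T ∘L star T : H →L[ℂ] H) x) ((T ∘L star T : H →L[ℂ] H) y) := by
    intro x hx y hy
    rw [dist_eq_norm, dist_eq_norm, ← map_sub, ← map_sub]
    have h1 : ‖star T (x - y)‖ ^ 2 = RCLike.re (inner ℂ (T (star T (x - y))) (x - y)) := by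
      rw [← ContinuousLinearMap.adjoint_inner_right, ← ContinuousLinearMap.star_eq_adjoint,
        inner_self_eq_norm_sq]
    rw [h1]
    have h2 : ‖x - y‖ ≤ 2 := by
      have hx' : ‖x‖ < 1 := by simpa using hx
      have hy' : ‖y‖ < 1 := by simpa using hy
      linarith [norm_sub_le x y]
    calc RCLike.re (inner ℂ (T (star T (x - y))) (x - y))
        ≤ ‖T (star T (x - y))‖ * ‖x - y‖ :=
          (RCLike.re_le_norm _).trans (norm_inner_le_norm _ _)
      _ ≤ ‖T (star T (x - y))‖ * 2 := by gcongr
      _ = 2 * ‖(T ∘L star T : H →L[ℂ] H) (x - y)‖ := by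
          rw [mul_comm]; rfl
  have htb : TotallyBounded ((star T : H →L[ℂ] H) '' Metric.ball 0 1) := by
    rw [Metric.totallyBounded_iff]
    intro ε hε
    obtain ⟨t, ht, htf, hcov⟩ := Metric.finite_approx_of_totallyBounded key (ε ^ 2 / 2)
      (by positivity)
    choose! g hg hgt using fun z (hz : z ∈ t) => ht hz
    refine ⟨(fun z => star T (g z)) '' t, htf.image _, ?_⟩
    rintro _ ⟨x, hx, rfl⟩
    have := hcov (Set.mem_image_of_mem _ hx)
    simp only [Set.mem_iUnion, Metric.mem_ball, exists_prop] at this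
    obtain ⟨z, hz, hxz⟩ := this
    simp only [Set.mem_iUnion, Metric.mem_ball, exists_prop]
    refine ⟨_, ⟨z, hz, rfl⟩, ?_⟩
    have h3 := hineq x hx (g z) (hg z hz)
    rw [hgt z hz] at h3
    exact lt_of_pow_lt_pow_left₀ 2 hε.le (by linarith)
  refine (isCompactOperator_iff_isCompact_closure_image_ball
    (f := ((star T : H →L[ℂ] H) : H →ₗ[ℂ] H)) zero_lt_one).2 ?_
  exact htb.closure.isCompact_of_isClosed isClosed_closure

/-- `𝓚(H)`: the `*`-algebra of all compact operators on a complex Hilbert space `H`. -/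
def compactOps (H : Type u) [NormedAddCommGroup H] [InnerProductSpace ℂ H] [CompleteSpace H] :
    NonUnitalStarSubalgebra ℂ (H →L[ℂ] H) where
  carrier := {T | IsCompactOperator T}
  add_mem' hf hg := hf.add hg
  zero_mem' := isCompactOperator_zero
  smul_mem' c _ hf := hf.smul c
  mul_mem' {_ g} hf _ := hf.comp_clm g
  star_mem' hf := isCompactOperator_adjoint hf

/-- The Hilbert space `ℓ₂(ι)` over `ℂ`. -/
abbrev EllTwo (ι : Type u) : Type u := lp (fun _ : ι => ℂ) 2

/-! ### Minimal projections and the algebra they generate -/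

/-- A minimal projection: a nonzero projection `p` with `p A p = ℂ p`. -/
structure IsMinimalProjection {A : Type u} [NonUnitalRing A] [StarRing A] [Module ℂ A]
    (p : A) : Prop where
  isStarProjection : IsStarProjection p
  ne_zero : p ≠ 0
  corner : ∀ a : A, ∃ c : ℂ, p * a * p = c • p

/-- `𝓘ᴬᵗ(A)`: the norm-closed `*`-subalgebra generated by the minimal projections
(as a set; the topology on `A` is the norm topology wherever this is used). -/
def atomIdeal (A : Type u) [NonUnitalRing A] [StarRing A] [Module ℂ A] [IsScalarTower ℂ A A]
    [SMulCommClass ℂ A A] [StarModule ℂ A] [TopologicalSpace A] : Set A :=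
  closure (NonUnitalStarAlgebra.adjoin ℂ {p : A | IsMinimalProjection p} : Set A)

/-- `A` is scattered if `𝓘ᴬᵗ(B) ≠ 0` for every nonzero `C*`-subalgebra `B` of `A`. -/
def IsScattered (A : Type u) [NonUnitalCStarAlgebra A] : Prop :=
  ∀ B : NonUnitalStarSubalgebra ℂ A, IsClosed (B : Set A) → B ≠ ⊥ →
    ∃ b ∈ atomIdeal B, b ≠ 0

/-! ### Closed ideals and quotients -/

/-- Closed two-sided ideals of a `C*`-algebra. (Such ideals are automatically self-adjoint linear
subspaces; recording this makes the quotient a `*`-algebra.) -/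
structure ClosedIdeal (A : Type u) [NonUnitalCStarAlgebra A] extends
    NonUnitalStarSubalgebra ℂ A where
  isClosed : IsClosed carrier
  mul_mem_left : ∀ (a : A) {x : A}, x ∈ carrier → a * x ∈ carrier
  mul_mem_right : ∀ (a : A) {x : A}, x ∈ carrier → x * a ∈ carrier

namespace ClosedIdeal

variable {A : Type u} [NonUnitalCStarAlgebra A] (I : ClosedIdeal A)

/-- The underlying linear subspace. -/
abbrev sub : Submodule ℂ A := I.toNonUnitalSubalgebra.toSubmodule

/-- The quotient `A / I`, with the quotient norm. -/
def QuotientAlg : Type u := A ⧸ I.sub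

instance : IsClosed (I.sub : Set A) := I.isClosed

instance : NormedAddCommGroup I.QuotientAlg := inferInstanceAs (NormedAddCommGroup (A ⧸ I.sub))

instance : NormedSpace ℂ I.QuotientAlg := inferInstanceAs (NormedSpace ℂ (A ⧸ I.sub))

/-- The class `[a]` of `a` in `A / I`. -/
def cls (a : A) : I.QuotientAlg := I.sub.mkQ a

theorem cls_surjective : Function.Surjective I.cls := I.sub.mkQ_surjective

theorem cls_eq_cls_iff {a b : A} : I.cls a = I.cls b ↔ a - b ∈ I.carrier :=
  Submodule.Quotient.eq I.sub

theorem cls_add (a b : A) : I.cls (a + b) = I.cls a + I.cls b := rfl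

theorem cls_smul (c : ℂ) (a : A) : I.cls (c • a) = c • I.cls a := rfl

instance : Mul I.QuotientAlg where
  mul := Quotient.map₂ (· * ·) (by
    intro a a' ha b b' hb
    have ha' : a - a' ∈ I.carrier := (Submodule.quotientRel_def I.sub).1 ha
    have hb' : b - b' ∈ I.carrier := (Submodule.quotientRel_def I.sub).1 hb
    refine (Submodule.quotientRel_def I.sub).2 ?_
    have h : a * b - a' * b' = a * (b - b') + (a - a') * b' := by
      rw [mul_sub, sub_mul]; abel
    rw [h]
    exact I.add_mem' (I.mul_mem_left _ hb') (I.mul_mem_right _ ha'))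

instance : Star I.QuotientAlg where
  star := Quotient.map star (by
    intro a a' ha
    have ha' : a - a' ∈ I.carrier := (Submodule.quotientRel_def I.sub).1 ha
    refine (Submodule.quotientRel_def I.sub).2 ?_
    rw [← star_sub]
    exact I.star_mem' ha')

theorem cls_mul (a b : A) : I.cls (a * b) = I.cls a * I.cls b := rfl

theorem cls_star (a : A) : I.cls (star a) = star (I.cls a) := rfl

instance : NonUnitalRing I.QuotientAlg :=
  { (inferInstance : AddCommGroup I.QuotientAlg), (inferInstance : Mul I.QuotientAlg) with
    left_distrib := by
      intro x y z
      obtain ⟨a, rfl⟩ := I.cls_surjective x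
      obtain ⟨b, rfl⟩ := I.cls_surjective y
      obtain ⟨c, rfl⟩ := I.cls_surjective z
      exact congrArg I.cls (mul_add a b c)
    right_distrib := by
      intro x y z
      obtain ⟨a, rfl⟩ := I.cls_surjective x
      obtain ⟨b, rfl⟩ := I.cls_surjective y
      obtain ⟨c, rfl⟩ := I.cls_surjective z
      exact congrArg I.cls (add_mul a b c)
    zero_mul := by
      intro x
      obtain ⟨a, rfl⟩ := I.cls_surjective x
      exact congrArg I.cls (zero_mul a)
    mul_zero := by
      intro x
      obtain ⟨a, rfl⟩ := I.cls_surjective x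
      exact congrArg I.cls (mul_zero a)
    mul_assoc := by
      intro x y z
      obtain ⟨a, rfl⟩ := I.cls_surjective x
      obtain ⟨b, rfl⟩ := I.cls_surjective y
      obtain ⟨c, rfl⟩ := I.cls_surjective z
      exact congrArg I.cls (mul_assoc a b c) }

instance : StarRing I.QuotientAlg where
  star_involutive := by
    intro x
    obtain ⟨a, rfl⟩ := I.cls_surjective x
    exact congrArg I.cls (star_star a)
  star_mul := by
    intro x y
    obtain ⟨a, rfl⟩ := I.cls_surjective x
    obtain ⟨b, rfl⟩ := I.cls_surjective y
    exact congrArg I.cls (star_mul a b)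
  star_add := by
    intro x y
    obtain ⟨a, rfl⟩ := I.cls_surjective x
    obtain ⟨b, rfl⟩ := I.cls_surjective y
    exact congrArg I.cls (star_add a b)

instance : StarModule ℂ I.QuotientAlg where
  star_smul := by
    intro c x
    obtain ⟨a, rfl⟩ := I.cls_surjective x
    exact congrArg I.cls (star_smul c a)

instance : IsScalarTower ℂ I.QuotientAlg I.QuotientAlg where
  smul_assoc := by
    intro c x y
    obtain ⟨a, rfl⟩ := I.cls_surjective x
    obtain ⟨b, rfl⟩ := I.cls_surjective y
    exact congrArg I.cls (smul_mul_assoc c a b)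

instance : SMulCommClass ℂ I.QuotientAlg I.QuotientAlg where
  smul_comm := by
    intro c x y
    obtain ⟨a, rfl⟩ := I.cls_surjective x
    obtain ⟨b, rfl⟩ := I.cls_surjective y
    exact congrArg I.cls (mul_smul_comm c a b).symm

/-- The quotient map `A → A / I` as a `*`-homomorphism. -/
def mkHom : A →⋆ₙₐ[ℂ] I.QuotientAlg where
  toFun := I.cls
  map_smul' _ _ := rfl
  map_zero' := rfl
  map_add' _ _ := rfl
  map_mul' _ _ := rfl
  map_star' _ := rfl

/-- The `*`-algebra `J / I`, realized as the image `{[a] : a ∈ J}` of `J` in `A / I`. -/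
def subquotient (J I : ClosedIdeal A) : NonUnitalStarSubalgebra ℂ I.QuotientAlg :=
  J.toNonUnitalStarSubalgebra.map I.mkHom

end ClosedIdeal

/-! ### Cantor–Bendixson sequences -/

/-- The Cantor–Bendixson sequence `(𝓘_α)_{α ≤ height}` of `A` (only the values of `ideal` at
ordinals `≤ height` matter): it is increasing and continuous, starts at `0`, satisfies
`𝓘ᴬᵗ(A / 𝓘_α) = {[a] : a ∈ 𝓘_{α+1}}`, and `height` is the first ordinal at which it reaches `A`.
The height and the ideals up to it are unique, see `CantorBendixson.unique`. -/
structure CantorBendixson (A : Type u) [NonUnitalCStarAlgebra A] where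
  height : Ordinal.{u}
  ideal : Ordinal.{u} → ClosedIdeal A
  ideal_zero : (ideal 0).carrier = {0}
  mono : ∀ α β, α ≤ β → β ≤ height → (ideal α).carrier ⊆ (ideal β).carrier
  limit : ∀ γ, γ ≤ height → Order.IsSuccLimit γ →
    (ideal γ).carrier = closure (⋃ α ∈ Set.Iio γ, (ideal α).carrier)
  succ : ∀ α, α < height →
    atomIdeal (ideal α).QuotientAlg = (ideal α).cls '' (ideal (Order.succ α)).carrier
  ideal_height : (ideal height).carrier = Set.univ
  ne_univ : ∀ α, α < height → (ideal α).carrier ≠ Set.univ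

namespace CantorBendixson

variable {A : Type u} [NonUnitalCStarAlgebra A]

theorem ideal_ext {I J : ClosedIdeal A} (h : I.carrier = J.carrier) : I = J := by
  obtain ⟨⟨⟨⟨⟨⟨I, _⟩, _⟩, _⟩, _⟩, _⟩, _, _, _⟩ := I
  obtain ⟨⟨⟨⟨⟨⟨J, _⟩, _⟩, _⟩, _⟩, _⟩, _, _, _⟩ := J
  congr

theorem ideal_eq (S T : CantorBendixson A) (α : Ordinal.{u}) :
    α ≤ S.height → α ≤ T.height → S.ideal α = T.ideal α := by
  induction α using Ordinal.limitRecOn with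
  | zero => intro _ _; exact ideal_ext (S.ideal_zero.trans T.ideal_zero.symm)
  | add_one α ih =>
    intro hS hT
    have hα : α < α + 1 := Order.lt_succ α
    have e := ih (hα.le.trans hS) (hα.le.trans hT)
    have h1 := S.succ α (hα.trans_le hS)
    have h2 := T.succ α (hα.trans_le hT)
    have hSle := S.mono α (Order.succ α) hα.le hS
    have hTle := T.mono α (Order.succ α) hα.le hT
    rw [e] at h1 hSle
    rw [h1] at h2
    have aux : ∀ J K : ClosedIdeal A, (T.ideal α).carrier ⊆ K.carrier →
        (T.ideal α).cls '' J.carrier = (T.ideal α).cls '' K.carrier → J.carrier ⊆ K.carrier := by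
      intro J K hK hJK x hx
      have : (T.ideal α).cls x ∈ (T.ideal α).cls '' K.carrier := hJK ▸ ⟨x, hx, rfl⟩
      obtain ⟨y, hy, hxy⟩ := this
      have h3 := hK ((T.ideal α).cls_eq_cls_iff.1 hxy.symm)
      simpa using K.add_mem' h3 hy
    exact ideal_ext ((aux _ _ hTle h2).antisymm (aux _ _ hSle h2.symm))
  | limit γ hγ ih =>
    intro hS hT
    refine ideal_ext ?_
    rw [S.limit γ hS hγ, T.limit γ hT hγ]
    congr 1
    refine Set.iUnion₂_congr fun α hα => ?_
    rw [ih α hα (hα.le.trans hS) (hα.le.trans hT)]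

/-- A `C*`-algebra has at most one Cantor–Bendixson sequence. -/
theorem unique (S T : CantorBendixson A) :
    S.height = T.height ∧ ∀ α ≤ S.height, S.ideal α = T.ideal α := by
  have h : S.height = T.height := by
    rcases lt_trichotomy S.height T.height with h | h | h
    · exact absurd (ideal_eq S T _ le_rfl h.le ▸ S.ideal_height) (T.ne_univ _ h)
    · exact h
    · exact absurd (ideal_eq S T _ h.le le_rfl ▸ T.ideal_height) (S.ne_univ _ h)
  exact ⟨h, fun α hα => ideal_eq S T α hα (h ▸ hα)⟩

variable (S : CantorBendixson A)

/-- The quotient `𝓘_{α+1} / 𝓘_α`. -/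
def layer (α : Ordinal.{u}) : NonUnitalStarSubalgebra ℂ (S.ideal α).QuotientAlg :=
  (S.ideal (Order.succ α)).subquotient (S.ideal α)

/-- Every `𝓘_{α+1} / 𝓘_α` is `*`-isomorphic to the algebra of all compact operators on some
Hilbert space. -/
def FullyNoncommutative : Prop :=
  ∀ α, α < S.height → ∃ (H : Type u) (_ : NormedAddCommGroup H) (_ : InnerProductSpace ℂ H)
    (_ : CompleteSpace H), Nonempty (S.layer α ≃⋆ₐ[ℂ] compactOps H)

/-- The `*`-algebra `L` is `*`-isomorphic to a nondegenerate `C*`-subalgebra of `𝓚(ℓ₂(ι))`. -/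
def IsNondegenerateSubalgebraOfCompacts (L : Type v) [NonUnitalRing L] [StarRing L] [Module ℂ L]
    (ι : Type w) : Prop :=
  ∃ B : NonUnitalStarSubalgebra ℂ (EllTwo ι →L[ℂ] EllTwo ι),
    B ≤ compactOps (EllTwo ι) ∧
    IsClosed (B : Set (EllTwo ι →L[ℂ] EllTwo ι)) ∧
    (Submodule.span ℂ {x : EllTwo ι | ∃ T ∈ B, ∃ y, T y = x}).topologicalClosure = ⊤ ∧
    Nonempty (L ≃⋆ₐ[ℂ] B)

/-- `κ` is the width: the supremum of all cardinals `μ` such that some `𝓘_{α+1} / 𝓘_α` is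
isomorphic to a nondegenerate subalgebra of `𝓚(ℓ₂(μ))`. -/
def IsWidth (κ : Cardinal.{u}) : Prop :=
  IsLUB {μ : Cardinal.{u} | ∃ α, α < S.height ∧
    IsNondegenerateSubalgebraOfCompacts (S.layer α) μ.out} κ

end CantorBendixson

/-! ### Stability -/

/-- `C` is a `C*`-tensor product of the `*`-algebras `A` and `B`: it is the completion of the
algebraic tensor product `A ⊗ B` in a `C*`-norm, that is, there is an injective `*`-homomorphism
with dense range from `A ⊗ B` to `C` (given by the bilinear map `φ : (a, b) ↦ a ⊗ b`).
If `B = 𝓚(ℓ₂)`, which is nuclear, then such a `C` is unique up to isomorphism. -/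
def IsCStarTensorProduct (A : Type u) (B : Type v) (C : Type w)
    [NonUnitalRing A] [StarRing A] [Module ℂ A] [NonUnitalRing B] [StarRing B] [Module ℂ B]
    [NonUnitalCStarAlgebra C] : Prop :=
  ∃ φ : A →ₗ[ℂ] B →ₗ[ℂ] C,
    (∀ a a' b b', φ (a * a') (b * b') = φ a b * φ a' b') ∧
    (∀ a b, φ (star a) (star b) = star (φ a b)) ∧
    Function.Injective (TensorProduct.lift φ : A ⊗[ℂ] B → C) ∧
    DenseRange (TensorProduct.lift φ : A ⊗[ℂ] B → C)

/-- `A` is stable: `A ≅ A ⊗ 𝓚(ℓ₂)`. -/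
def IsStable (A : Type u) [NonUnitalCStarAlgebra A] : Prop :=
  ∃ (C : Type u) (_ : NonUnitalCStarAlgebra C),
    IsCStarTensorProduct A (compactOps (EllTwo ℕ)) C ∧ Nonempty (A ≃⋆ₐ[ℂ] C)

end ScatteredCStar

end

noncomputable section

namespace ScatteredCStar

/-! ### Operators on `ℓ₂(X)` and their matrices -/

section EllTwoOperators

variable {X : Type u} {Y : Type v} {Z : Type w}

/-! The algebra is built concretely on `ℓ₂(X)`, where `X` consists of the finitely supported
functions `θ → K` paired with a natural number, and `K` has cardinality `κ`. For a level `o` and `s,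
t ∈ X`, let `e^o_{s,t}` be the partial isometry that takes a basis vector `x` agreeing with `t` from
level `o` on and replaces that part of `x` by the corresponding part of `s`; it kills the other
basis vectors. The natural number counts as lying above all levels. For `o ≤ o'` a product of a unit
at level `o` with one at level `o'`, in either order, is zero or again a unit at level `o`. Hence
the closed spans `A_b` of the units at levels `< b` are closed ideals of `A_θ`, increasing and
continuous in `b`, with `A_0 = 0`.

To compute the layers, split `X` at `α` as upper part × lower part. Units at levels `≥ α` have the
form `T ⊗ 1`, and those at level `α` are exactly `(matrix unit) ⊗ 1`. Units at levels `< α` die on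
suitable slices over the lower part: since `K` is infinite, finitely many forbidden values can be
avoided at finitely many coordinates. So if `a - T ⊗ 1 ∈ A_α` then `‖T‖ ≤ ‖a‖`
(`Represents.norm_le`). Such a `T` is therefore unique and, by completeness, exists for every `a ∈
A_θ`. The map `a ↦ T` is a representation with kernel `A_α` under which the preimage of the compact
operators is `A_{α+1}`, and `k ↦ k ⊗ 1` splits it over the compact operators (`levelSeries`).

The rest is formal. A faithful representation of `A/A_α` whose image contains the compact operators
sends minimal projections to compact operators, and these projections generate exactly the compact
operators, so the `A_α` form the Cantor–Bendixson sequence (`atomIdeal_quotient`). Scatteredness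
follows by looking at the first `A_γ` met by a subalgebra: `γ` is a successor, and an element of
least rank in a faithful representation yields a minimal projection. The width is found by counting
coordinates, using that compact operators have separable range. Stability holds because the natural
number coordinate absorbs another factor `ℕ`: `e^o_{s,t} ⊗ e_{k,l}` is again a unit at level `o`. -/

open Classical in
/-- The standard basis vector of `ℓ₂(X)` at `x`. -/
def stdVec (x : X) : EllTwo X := lp.single 2 x (1 : ℂ)

open Classical in
theorem stdVec_apply (x y : X) : stdVec x y = if y = x then 1 else 0 := by
  simp [stdVec, lp.single_apply, Pi.single_apply]

theorem stdVec_self (x : X) : stdVec x x = 1 := by simp [stdVec_apply]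

theorem norm_stdVec (x : X) : ‖stdVec x‖ = 1 := by
  classical
  simp [stdVec]

theorem hasSum_stdVec (f : EllTwo X) : HasSum (fun x => f x • stdVec x) f := by
  classical
  have := lp.hasSum_single (E := fun _ : X => ℂ) (p := 2) (by norm_num) f
  convert this using 2 with x
  rw [stdVec, ← lp.single_smul]
  simp

theorem inner_stdVec_left (x : X) (f : EllTwo X) : inner ℂ (stdVec x) f = f x := by
  classical
  simp [stdVec, lp.inner_single_left]

theorem inner_stdVec_right (x : X) (f : EllTwo X) : inner ℂ f (stdVec x) = star (f x) := by
  rw [← inner_conj_symm, inner_stdVec_left]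
  rfl

theorem ellTwo_ext {f g : EllTwo X} (h : ∀ x, f x = g x) : f = g := lp.ext (funext h)

theorem ellTwo_add_apply (f g : EllTwo X) (x : X) : (f + g) x = f x + g x := rfl

theorem ellTwo_smul_apply (c : ℂ) (f : EllTwo X) (x : X) : (c • f) x = c * f x := rfl

theorem ellTwo_zero_apply (x : X) : (0 : EllTwo X) x = 0 := rfl

theorem clm_ext_stdVec {F : Type*} [NormedAddCommGroup F] [NormedSpace ℂ F]
    {S T : EllTwo X →L[ℂ] F} (h : ∀ x, S (stdVec x) = T (stdVec x)) : S = T := by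
  ext1 f
  have hS := (hasSum_stdVec f).mapL S
  have hT := (hasSum_stdVec f).mapL T
  simp only [map_smul, h] at hS hT
  exact hS.unique hT

theorem clm_ext_matrix {S T : EllTwo X →L[ℂ] EllTwo Y}
    (h : ∀ x y, S (stdVec x) y = T (stdVec x) y) : S = T :=
  clm_ext_stdVec fun x => ellTwo_ext (h x)

theorem star_apply_stdVec (T : EllTwo X →L[ℂ] EllTwo X) (x y : X) :
    (star T) (stdVec x) y = star (T (stdVec y) x) := by
  rw [← inner_stdVec_left y, ContinuousLinearMap.star_eq_adjoint,
    ContinuousLinearMap.adjoint_inner_right, inner_stdVec_right]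

theorem norm_sq_eq_hasSum (f : EllTwo X) : HasSum (fun x => ‖f x‖ ^ 2) (‖f‖ ^ 2) := by
  have := lp.hasSum_norm (E := fun _ : X => ℂ) (p := 2) (by norm_num) f
  simpa using this

theorem memlp_two_of_sum_le {f : X → ℂ} (C : ℝ) (h : ∀ s : Finset X, ∑ x ∈ s, ‖f x‖ ^ 2 ≤ C) :
    Memℓp f 2 :=
  memℓp_gen' (C := C) (by simpa using h)

theorem norm_le_of_sum_sq_le {f : EllTwo X} {C : ℝ} (hC : 0 ≤ C)
    (h : ∀ s : Finset X, ∑ x ∈ s, ‖f x‖ ^ 2 ≤ C ^ 2) : ‖f‖ ≤ C :=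
  lp.norm_le_of_forall_sum_le (p := 2) (by norm_num) hC (by simpa using h)

/-! ### Operators induced by partial bijections -/

/-- Since `σ` is injective where defined, each coordinate of `f` is used at most once. -/
theorem sum_sq_partial_le (σ : X ≃. Y) (f : EllTwo X) (s : Finset Y) :
    ∑ y ∈ s, ‖(σ.symm y).elim 0 f‖ ^ 2 ≤ ‖f‖ ^ 2 := by
  classical
  have h1 : ∀ y, ‖(σ.symm y).elim 0 f‖ ^ 2 = ∑ x ∈ (σ.symm y).toFinset, ‖f x‖ ^ 2 := by
    intro y
    cases σ.symm y <;> simp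
  simp only [h1]
  rw [← Finset.sum_biUnion]
  · exact sum_le_hasSum _ (fun _ _ => by positivity) (norm_sq_eq_hasSum f)
  · intro a _ b _ hab
    rw [Function.onFun, Finset.disjoint_left]
    intro x hxa hxb
    rw [Option.mem_toFinset] at hxa hxb
    rw [PEquiv.mem_iff_mem] at hxa hxb
    exact hab (Option.mem_unique hxa hxb)

/-- The partial isometry `ℓ₂(X) → ℓ₂(Y)` induced by a partial bijection from `X` to `Y`. -/
def partialOp (σ : X ≃. Y) : EllTwo X →L[ℂ] EllTwo Y :=
  LinearMap.mkContinuous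
    { toFun := fun f => ⟨fun y => (σ.symm y).elim 0 f,
        memlp_two_of_sum_le (‖f‖ ^ 2) (sum_sq_partial_le σ f)⟩
      map_add' := fun f g => by
        refine ellTwo_ext fun y => ?_
        change (σ.symm y).elim 0 (f + g : EllTwo X) =
          (σ.symm y).elim 0 f + (σ.symm y).elim 0 g
        cases σ.symm y
        · exact (add_zero 0).symm
        · rfl
      map_smul' := fun c f => by
        refine ellTwo_ext fun y => ?_
        change (σ.symm y).elim 0 (c • f : EllTwo X) = c * (σ.symm y).elim 0 f
        cases σ.symm y
        · exact (mul_zero c).symm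
        · rfl } 1
    (fun f => by
      rw [one_mul]
      exact norm_le_of_sum_sq_le (norm_nonneg f) (sum_sq_partial_le σ f))

theorem partialOp_apply (σ : X ≃. Y) (f : EllTwo X) (y : Y) :
    partialOp σ f y = (σ.symm y).elim 0 f := rfl

theorem norm_partialOp_le (σ : X ≃. Y) : ‖partialOp σ‖ ≤ 1 :=
  LinearMap.mkContinuous_norm_le _ zero_le_one _

open Classical in
theorem partialOp_stdVec_apply (σ : X ≃. Y) (x : X) (y : Y) :
    partialOp σ (stdVec x) y = if y ∈ σ x then 1 else 0 := by
  rw [partialOp_apply]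
  cases h : σ.symm y with
  | none =>
    rw [if_neg]
    · rfl
    · rw [← PEquiv.mem_iff_mem, h]; simp
  | some x' =>
    have h1 : y ∈ σ x ↔ x = x' := by rw [← PEquiv.mem_iff_mem, h]; simp [eq_comm]
    change stdVec x x' = _
    simp [stdVec_apply, h1, eq_comm]

theorem partialOp_stdVec (σ : X ≃. Y) {x : X} {y : Y} (h : σ x = some y) :
    partialOp σ (stdVec x) = stdVec y := by
  classical
  refine ellTwo_ext fun z => ?_
  rw [partialOp_stdVec_apply, stdVec_apply, h]
  simp [eq_comm]

theorem partialOp_stdVec_of_eq_none (σ : X ≃. Y) {x : X} (h : σ x = none) :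
    partialOp σ (stdVec x) = 0 := by
  classical
  refine ellTwo_ext fun z => ?_
  rw [partialOp_stdVec_apply, h]
  simp [ellTwo_zero_apply]

theorem partialOp_trans {W : Type*} (σ : X ≃. Y) (τ : Y ≃. W) :
    partialOp (σ.trans τ) = partialOp τ ∘L partialOp σ := by
  refine clm_ext_stdVec fun x => ?_
  rw [ContinuousLinearMap.comp_apply]
  cases h : σ x with
  | none =>
    rw [partialOp_stdVec_of_eq_none σ h, map_zero, partialOp_stdVec_of_eq_none]
    rw [PEquiv.trans_eq_none]; simp [h]
  | some y =>
    rw [partialOp_stdVec σ h]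
    cases h' : τ y with
    | none =>
      rw [partialOp_stdVec_of_eq_none τ h', partialOp_stdVec_of_eq_none]
      rw [PEquiv.trans_eq_none]; intro b c
      by_cases hb : b = y
      · right; simp [hb, h']
      · left; simp [h, Ne.symm hb]
    | some z =>
      rw [partialOp_stdVec τ h', partialOp_stdVec]
      rw [PEquiv.trans_eq_some]; exact ⟨y, h, h'⟩

theorem partialOp_refl : partialOp (PEquiv.refl X) = ContinuousLinearMap.id ℂ (EllTwo X) :=
  clm_ext_stdVec fun x => by rw [partialOp_stdVec _ (PEquiv.refl_apply x)]; rfl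

theorem partialOp_bot : partialOp (⊥ : X ≃. Y) = 0 :=
  clm_ext_stdVec fun x => by rw [partialOp_stdVec_of_eq_none _ (PEquiv.bot_apply x)]; rfl

theorem star_partialOp (σ : X ≃. X) : star (partialOp σ) = partialOp σ.symm := by
  classical
  refine clm_ext_matrix fun x y => ?_
  rw [star_apply_stdVec, partialOp_stdVec_apply, partialOp_stdVec_apply]
  simp only [PEquiv.mem_iff_mem]
  split_ifs <;> simp

/-! ### Matrix units and compact operators -/

open Classical in
/-- The matrix unit sending the basis vector at `t` to the one at `s`. -/
def matrixUnit (s t : X) : EllTwo X →L[ℂ] EllTwo X := partialOp (PEquiv.single t s)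

theorem matrixUnit_apply (s t : X) (f : EllTwo X) : matrixUnit s t f = f t • stdVec s := by
  classical
  refine ellTwo_ext fun y => ?_
  rw [matrixUnit, partialOp_apply, PEquiv.symm_single, ellTwo_smul_apply, stdVec_apply]
  by_cases h : y = s
  · subst h; simp
  · rw [PEquiv.single_apply_of_ne (Ne.symm h)]; simp [h]

theorem matrixUnit_eq_rankOne (s t : X) :
    matrixUnit s t = InnerProductSpace.rankOne ℂ (stdVec s) (stdVec t) := by
  ext1 f
  rw [matrixUnit_apply, InnerProductSpace.rankOne_apply, inner_stdVec_left]

theorem star_matrixUnit (s t : X) : star (matrixUnit s t) = matrixUnit t s := by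
  classical
  rw [matrixUnit, star_partialOp, PEquiv.symm_single, matrixUnit]

theorem matrixUnit_mul_matrixUnit (r s t : X) :
    matrixUnit r s * matrixUnit s t = matrixUnit r t := by
  ext1 f
  simp [matrixUnit_apply, stdVec_self]

theorem matrixUnit_ne_zero (s t : X) : matrixUnit s t ≠ 0 := by
  intro h
  have h1 : (matrixUnit s t) (stdVec t) s = 0 := by rw [h]; rfl
  simp [matrixUnit_apply, stdVec_self] at h1

theorem isCompactOperator_rankOne {H : Type u} [NormedAddCommGroup H] [InnerProductSpace ℂ H]
    (v w : H) : IsCompactOperator (InnerProductSpace.rankOne ℂ v w : H →L[ℂ] H) := by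
  have h : (InnerProductSpace.rankOne ℂ v w : H → H) =
      (ContinuousLinearMap.toSpanSingleton ℂ v) ∘ (innerSL ℂ w : H →L[ℂ] ℂ) := by
    funext f
    simp
  rw [h]
  exact (isCompactOperator_of_locallyCompactSpace_dom (innerSL ℂ w : H →L[ℂ] ℂ)).clm_comp _

theorem isCompactOperator_matrixUnit (s t : X) : IsCompactOperator (matrixUnit s t) := by
  rw [matrixUnit_eq_rankOne]
  exact isCompactOperator_rankOne _ _

theorem matrixUnit_mem_compactOps (s t : X) : matrixUnit s t ∈ compactOps (EllTwo X) :=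
  isCompactOperator_matrixUnit s t

theorem isClosed_compactOps (H : Type u) [NormedAddCommGroup H] [InnerProductSpace ℂ H]
    [CompleteSpace H] : IsClosed (compactOps H : Set (H →L[ℂ] H)) :=
  isClosed_setOfPred_isCompactOperator

/-- The coordinate projection of `ℓ₂(X)` onto a finite set of coordinates. -/
def coordProj (F : Finset X) : EllTwo X →L[ℂ] EllTwo X := ∑ x ∈ F, matrixUnit x x

theorem coordProj_apply (F : Finset X) (f : EllTwo X) :
    coordProj F f = ∑ x ∈ F, f x • stdVec x := by
  simp [coordProj, matrixUnit_apply]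

theorem norm_coordProj_le (F : Finset X) : ‖coordProj F‖ ≤ 1 := by
  classical
  have : coordProj F = partialOp (PEquiv.ofSet (F : Set X)) := by
    refine clm_ext_matrix fun x y => ?_
    rw [coordProj_apply, partialOp_stdVec_apply]
    simp only [stdVec_apply, PEquiv.mem_ofSet_iff]
    simp only [ite_smul, one_smul, zero_smul]
    rw [Finset.sum_ite_eq']
    by_cases hx : x ∈ F
    · simp only [hx, if_true, stdVec_apply, Finset.mem_coe]
      by_cases hxy : y = x <;> grind
    · simp only [hx, if_false, ellTwo_zero_apply, Finset.mem_coe]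
      grind
  rw [this]
  exact norm_partialOp_le _

theorem tendsto_coordProj (f : EllTwo X) :
    Filter.Tendsto (fun F : Finset X => coordProj F f) Filter.atTop (nhds f) := by
  simp only [coordProj_apply]
  exact hasSum_stdVec f

/-- The image of the unit ball has a finite `ε/3`-net. Coordinate projections converge strongly to
the identity, hence uniformly on the net, and being contractions they are then uniformly close to
the identity on the whole image. -/
theorem exists_norm_coordProj_mul_sub_le {T : EllTwo X →L[ℂ] EllTwo X} (hT : IsCompactOperator T)
    {ε : ℝ} (hε : 0 < ε) : ∃ F : Finset X, ‖coordProj F * T - T‖ ≤ ε := by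
  have key : TotallyBounded (T '' Metric.closedBall 0 1) :=
    ((hT.isCompact_closure_image_closedBall (f := (T : EllTwo X →ₗ[ℂ] EllTwo X))
      1).totallyBounded).subset subset_closure
  obtain ⟨t, ht, htf, hcov⟩ := Metric.finite_approx_of_totallyBounded key (ε / 3) (by positivity)
  have hev : ∀ᶠ F : Finset X in Filter.atTop, ∀ y ∈ t, dist (coordProj F y) y < ε / 3 := by
    rw [Filter.eventually_all_finite htf]
    intro y _
    exact Metric.tendsto_nhds.1 (tendsto_coordProj y) _ (by positivity)
  obtain ⟨F, hF⟩ := hev.exists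
  refine ⟨F, ContinuousLinearMap.opNorm_le_of_unit_norm hε.le fun x hx => ?_⟩
  have hx' : T x ∈ T '' Metric.closedBall 0 1 := ⟨x, by simp [hx], rfl⟩
  have h1 := hcov hx'
  simp only [Set.mem_iUnion, Metric.mem_ball, exists_prop] at h1
  obtain ⟨y, hy, hxy⟩ := h1
  have h2 := hF y hy
  rw [dist_eq_norm] at hxy h2
  have h3 : ‖coordProj F (T x - y)‖ ≤ ‖T x - y‖ := by
    simpa using (coordProj F).le_of_opNorm_le (norm_coordProj_le F) (T x - y)
  have h4 : (coordProj F * T - T) x =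
      coordProj F (T x - y) + (coordProj F y - y) - (T x - y) := by
    rw [map_sub]
    change coordProj F (T x) - T x = _
    abel
  rw [h4]
  have h5 := norm_sub_le (coordProj F (T x - y) + (coordProj F y - y)) (T x - y)
  have h6 := norm_add_le (coordProj F (T x - y)) (coordProj F y - y)
  linarith

theorem rankOne_stdVec_mem_closure_span (s : X) (g : EllTwo X) :
    InnerProductSpace.rankOne ℂ (stdVec s) g ∈
      (Submodule.span ℂ {T | ∃ s t : X, T = matrixUnit s t}).topologicalClosure := by
  have h := (hasSum_stdVec g).map (InnerProductSpace.rankOne ℂ (stdVec s) :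
    EllTwo X →L⋆[ℂ] EllTwo X →L[ℂ] EllTwo X) (ContinuousLinearMap.continuous _)
  refine mem_closure_of_tendsto h (Filter.Eventually.of_forall fun F => ?_)
  refine Submodule.sum_mem _ fun t _ => ?_
  simp only [Function.comp_apply, ContinuousLinearMap.map_smulₛₗ, ← matrixUnit_eq_rankOne]
  exact Submodule.smul_mem _ _ (Submodule.subset_span ⟨s, t, rfl⟩)

/-- Compact operators on `ℓ₂(X)` are norm limits of finite combinations of matrix units. -/
theorem mem_closure_span_matrixUnit {T : EllTwo X →L[ℂ] EllTwo X} (hT : IsCompactOperator T) :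
    T ∈ (Submodule.span ℂ {T | ∃ s t : X, T = matrixUnit s t}).topologicalClosure := by
  set C := (Submodule.span ℂ {T | ∃ s t : X, T = matrixUnit s t}).topologicalClosure with hC
  have hcl : IsClosed (C : Set (EllTwo X →L[ℂ] EllTwo X)) :=
    Submodule.isClosed_topologicalClosure _
  rw [← SetLike.mem_coe, ← hcl.closure_eq, Metric.mem_closure_iff]
  intro ε hε
  obtain ⟨F, hF⟩ := exists_norm_coordProj_mul_sub_le hT (half_pos hε)
  refine ⟨coordProj F * T, ?_, ?_⟩
  -- The truncation is a finite sum of rank-one operators `f ↦ ⟨T* e_x, f⟩ e_x`, each of which is a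
  -- limit obtained by expanding `T* e_x` in the basis.
  · rw [coordProj, Finset.sum_mul]
    refine Submodule.sum_mem _ fun x _ => ?_
    have : matrixUnit x x * T = InnerProductSpace.rankOne ℂ (stdVec x) (star T (stdVec x)) := by
      ext1 f
      rw [InnerProductSpace.rankOne_apply, ContinuousLinearMap.star_eq_adjoint,
        ContinuousLinearMap.adjoint_inner_left, inner_stdVec_left]
      exact matrixUnit_apply x x (T f)
    rw [this]
    exact rankOne_stdVec_mem_closure_span _ _
  · rw [dist_comm, dist_eq_norm]
    linarith

/-! ### Amplification -/

open Classical in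
/-- The inclusion of the slice over `z` under an identification `Y × Z ≃ X`. -/
def slice (e : Y × Z ≃ X) (z : Z) : Y ≃. X where
  toFun y := some (e (y, z))
  invFun x := if (e.symm x).2 = z then some (e.symm x).1 else none
  inv y x := by
    by_cases h : (e.symm x).2 = z
    · subst h
      have h1 : e (y, (e.symm x).2) = x ↔ (e.symm x).1 = y := by
        rw [← Equiv.eq_symm_apply, Prod.ext_iff]
        simp [eq_comm]
      simp [h1]
    · have : e (y, z) ≠ x := by rintro rfl; simp at h
      simp [h, this]

theorem slice_apply (e : Y × Z ≃ X) (z : Z) (y : Y) : slice e z y = some (e (y, z)) := rfl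

theorem slice_symm_apply (e : Y × Z ≃ X) (z : Z) (y : Y) :
    (slice e z).symm (e (y, z)) = some y :=
  (PEquiv.eq_some_iff _).2 rfl

theorem slice_symm_apply_of_ne (e : Y × Z ≃ X) {z z' : Z} (h : z' ≠ z) (y : Y) :
    (slice e z).symm (e (y, z')) = none := by
  rw [Option.eq_none_iff_forall_ne_some]
  intro y' hy'
  rw [PEquiv.eq_some_iff, slice_apply, Option.some_inj, e.apply_eq_iff_eq, Prod.mk.injEq] at hy'
  exact h hy'.2.symm

theorem partialOp_slice_symm_apply (e : Y × Z ≃ X) (z : Z) (f : EllTwo X) (y : Y) :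
    partialOp (slice e z).symm f y = f (e (y, z)) := rfl

theorem partialOp_slice_symm_comp (e : Y × Z ≃ X) (z : Z) :
    partialOp (slice e z).symm ∘L partialOp (slice e z) = ContinuousLinearMap.id ℂ (EllTwo Y) := by
  rw [← partialOp_trans, ← partialOp_refl]
  congr 1
  ext1 y
  rw [PEquiv.refl_apply, PEquiv.trans_eq_some]
  exact ⟨e (y, z), rfl, slice_symm_apply e z y⟩

theorem hasSum_norm_sq_slice (e : Y × Z ≃ X) (f : EllTwo X) :
    HasSum (fun z => ‖partialOp (slice e z).symm f‖ ^ 2) (‖f‖ ^ 2) := by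
  have h1 : HasSum (fun p : Z × Y => ‖f (e (p.2, p.1))‖ ^ 2) (‖f‖ ^ 2) :=
    (((Equiv.prodComm Z Y).trans e).hasSum_iff (f := fun x => ‖f x‖ ^ 2)).2 (norm_sq_eq_hasSum f)
  exact h1.prod_fiberwise fun z => norm_sq_eq_hasSum (partialOp (slice e z).symm f)

/-- Enclose `s` in a finite rectangle, bound each slice by `‖T‖`, and use that the squared norms of
the slices of `f` add up to `‖f‖ ^ 2`. -/
theorem sum_sq_amplify_le (e : Y × Z ≃ X) (T : EllTwo Y →L[ℂ] EllTwo Y) (f : EllTwo X)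
    (s : Finset X) :
    ∑ x ∈ s, ‖T (partialOp (slice e (e.symm x).2).symm f) (e.symm x).1‖ ^ 2 ≤
      (‖T‖ * ‖f‖) ^ 2 := by
  classical
  set P := s.image fun x => (e.symm x).2
  set Q := s.image fun x => (e.symm x).1
  have h1 : ∑ x ∈ s, ‖T (partialOp (slice e (e.symm x).2).symm f) (e.symm x).1‖ ^ 2 ≤
      ∑ p ∈ P ×ˢ Q, ‖T (partialOp (slice e p.1).symm f) p.2‖ ^ 2 := by
    rw [← Finset.sum_image (s := s) (g := fun x => ((e.symm x).2, (e.symm x).1))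
      (f := fun p : Z × Y => ‖T (partialOp (slice e p.1).symm f) p.2‖ ^ 2)]
    · refine Finset.sum_le_sum_of_subset_of_nonneg ?_ fun _ _ _ => by positivity
      intro p hp
      obtain ⟨x, hx, rfl⟩ := Finset.mem_image.1 hp
      exact Finset.mem_product.2 ⟨Finset.mem_image.2 ⟨x, hx, rfl⟩, Finset.mem_image.2 ⟨x, hx, rfl⟩⟩
    · intro x _ y _ hxy
      rw [Prod.mk.injEq] at hxy
      exact e.symm.injective (Prod.ext hxy.2 hxy.1)
  refine h1.trans ?_
  rw [Finset.sum_product]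
  have h2 : ∀ z ∈ P, ∑ y ∈ Q, ‖T (partialOp (slice e z).symm f) y‖ ^ 2 ≤
      ‖T‖ ^ 2 * ‖partialOp (slice e z).symm f‖ ^ 2 := by
    intro z _
    rw [← mul_pow]
    exact (sum_le_hasSum _ (fun _ _ => by positivity)
      (norm_sq_eq_hasSum (T (partialOp (slice e z).symm f)))).trans
        (pow_le_pow_left₀ (norm_nonneg _) (T.le_opNorm _) 2)
  refine (Finset.sum_le_sum h2).trans ?_
  rw [← Finset.mul_sum, mul_pow]
  gcongr
  exact sum_le_hasSum _ (fun _ _ => by positivity) (hasSum_norm_sq_slice e f)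

/-- The operator `T ⊗ 1` on `ℓ₂(X)`, for an identification `Y × Z ≃ X`. -/
def amplifyOp (e : Y × Z ≃ X) (T : EllTwo Y →L[ℂ] EllTwo Y) : EllTwo X →L[ℂ] EllTwo X :=
  LinearMap.mkContinuous
    { toFun := fun f => ⟨fun x => T (partialOp (slice e (e.symm x).2).symm f) (e.symm x).1,
        memlp_two_of_sum_le _ (sum_sq_amplify_le e T f)⟩
      map_add' := fun f g => ellTwo_ext fun x => by
        simp only [map_add]
        rfl
      map_smul' := fun c f => ellTwo_ext fun x => by
        simp only [map_smul]
        rfl } ‖T‖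
    (fun f => norm_le_of_sum_sq_le (by positivity) (sum_sq_amplify_le e T f))

theorem amplifyOp_apply (e : Y × Z ≃ X) (T : EllTwo Y →L[ℂ] EllTwo Y) (f : EllTwo X) (y : Y)
    (z : Z) : amplifyOp e T f (e (y, z)) = T (partialOp (slice e z).symm f) y := by
  change T (partialOp (slice e (e.symm (e (y, z))).2).symm f) (e.symm (e (y, z))).1 = _
  rw [e.symm_apply_apply]

theorem partialOp_slice_symm_amplifyOp (e : Y × Z ≃ X) (T : EllTwo Y →L[ℂ] EllTwo Y) (z : Z) :
    partialOp (slice e z).symm ∘L amplifyOp e T = T ∘L partialOp (slice e z).symm := by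
  ext1 f
  exact ellTwo_ext fun y => amplifyOp_apply e T f y z

theorem clm_ext_slice {F : Type*} [NormedAddCommGroup F] [NormedSpace ℂ F] (e : Y × Z ≃ X)
    {S T : F →L[ℂ] EllTwo X}
    (h : ∀ z, partialOp (slice e z).symm ∘L S = partialOp (slice e z).symm ∘L T) : S = T := by
  ext1 f
  refine ellTwo_ext fun x => ?_
  obtain ⟨⟨y, z⟩, rfl⟩ := e.surjective x
  have := congrArg (fun R : F →L[ℂ] EllTwo Y => R f y) (h z)
  exact this

/-- Slices are isometric copies of `ℓ₂(Y)` on which `T ⊗ 1` acts as `T`; this is how norm estimates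
for operators on `ℓ₂(X)` come back to `T`. -/
theorem amplifyOp_comp_slice (e : Y × Z ≃ X) (T : EllTwo Y →L[ℂ] EllTwo Y) (z : Z) :
    amplifyOp e T ∘L partialOp (slice e z) = partialOp (slice e z) ∘L T := by
  refine clm_ext_slice e fun z' => ?_
  rw [← ContinuousLinearMap.comp_assoc, partialOp_slice_symm_amplifyOp,
    ContinuousLinearMap.comp_assoc, ← ContinuousLinearMap.comp_assoc _ _ T]
  by_cases h : z = z'
  · subst h
    rw [partialOp_slice_symm_comp]
    rfl
  · have : partialOp (slice e z').symm ∘L partialOp (slice e z) = 0 := by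
      rw [← partialOp_trans, ← partialOp_bot]
      congr 1
      ext1 y
      rw [PEquiv.bot_apply, PEquiv.trans_eq_none]
      intro x y'
      by_cases hx : x = e (y, z)
      · right; rw [hx, slice_symm_apply_of_ne e h]; simp
      · left; rw [slice_apply]; simp [Ne.symm hx]
    rw [this]
    simp

theorem amplifyOp_stdVec (e : Y × Z ≃ X) (T : EllTwo Y →L[ℂ] EllTwo Y) (y : Y) (z : Z) :
    amplifyOp e T (stdVec (e (y, z))) = partialOp (slice e z) (T (stdVec y)) := by
  rw [← partialOp_stdVec (slice e z) (slice_apply e z y)]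
  exact congrArg (fun R : EllTwo Y →L[ℂ] EllTwo X => R (stdVec y)) (amplifyOp_comp_slice e T z)

theorem partialOp_slice_apply_self (e : Y × Z ≃ X) (z : Z) (f : EllTwo Y) (y : Y) :
    partialOp (slice e z) f (e (y, z)) = f y := by
  rw [partialOp_apply, slice_symm_apply]; rfl

theorem partialOp_slice_apply_of_ne (e : Y × Z ≃ X) {z z' : Z} (h : z' ≠ z) (f : EllTwo Y) (y : Y) :
    partialOp (slice e z) f (e (y, z')) = 0 := by
  rw [partialOp_apply, slice_symm_apply_of_ne e h]; rfl

theorem amplifyOp_star (e : Y × Z ≃ X) (T : EllTwo Y →L[ℂ] EllTwo Y) :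
    amplifyOp e (star T) = star (amplifyOp e T) := by
  refine clm_ext_matrix fun x x' => ?_
  obtain ⟨⟨y, z⟩, rfl⟩ := e.surjective x
  obtain ⟨⟨y', z'⟩, rfl⟩ := e.surjective x'
  rw [star_apply_stdVec, amplifyOp_stdVec, amplifyOp_stdVec]
  by_cases h : z = z'
  · subst h
    rw [partialOp_slice_apply_self, partialOp_slice_apply_self, star_apply_stdVec]
  · rw [partialOp_slice_apply_of_ne e h, partialOp_slice_apply_of_ne e (Ne.symm h), star_zero]

/-- Amplification `T ↦ T ⊗ 1` as a `*`-homomorphism. -/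
def amplify (e : Y × Z ≃ X) : (EllTwo Y →L[ℂ] EllTwo Y) →⋆ₙₐ[ℂ] (EllTwo X →L[ℂ] EllTwo X) where
  toFun := amplifyOp e
  map_smul' c T := by
    ext1 f
    refine ellTwo_ext fun x => ?_
    obtain ⟨⟨y, z⟩, rfl⟩ := e.surjective x
    change amplifyOp e (c • T) f (e (y, z)) = c * amplifyOp e T f (e (y, z))
    rw [amplifyOp_apply, amplifyOp_apply]
    rfl
  map_zero' := by
    ext1 f
    refine ellTwo_ext fun x => ?_
    obtain ⟨⟨y, z⟩, rfl⟩ := e.surjective x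
    rw [amplifyOp_apply]
    rfl
  map_add' S T := by
    ext1 f
    refine ellTwo_ext fun x => ?_
    obtain ⟨⟨y, z⟩, rfl⟩ := e.surjective x
    change amplifyOp e (S + T) f (e (y, z)) =
      amplifyOp e S f (e (y, z)) + amplifyOp e T f (e (y, z))
    rw [amplifyOp_apply, amplifyOp_apply, amplifyOp_apply]
    rfl
  map_mul' S T := by
    refine clm_ext_slice e fun z => ?_
    change _ = partialOp (slice e z).symm ∘L (amplifyOp e S ∘L amplifyOp e T)
    rw [partialOp_slice_symm_amplifyOp, ← ContinuousLinearMap.comp_assoc,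
      partialOp_slice_symm_amplifyOp, ContinuousLinearMap.comp_assoc,
      partialOp_slice_symm_amplifyOp]
    rfl
  map_star' T := amplifyOp_star e T

theorem amplify_apply (e : Y × Z ≃ X) (T : EllTwo Y →L[ℂ] EllTwo Y) :
    amplify e T = amplifyOp e T := rfl

theorem norm_partialOp_slice_apply (e : Y × Z ≃ X) (z : Z) (f : EllTwo Y) :
    ‖partialOp (slice e z) f‖ = ‖f‖ := by
  refine le_antisymm ?_ ?_
  · simpa using (partialOp (slice e z)).le_of_opNorm_le (norm_partialOp_le _) f
  · have h : partialOp (slice e z).symm (partialOp (slice e z) f) = f :=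
      congrArg (fun R : EllTwo Y →L[ℂ] EllTwo Y => R f) (partialOp_slice_symm_comp e z)
    have h2 := (partialOp (slice e z).symm).le_of_opNorm_le (norm_partialOp_le _)
      (partialOp (slice e z) f)
    rw [h, one_mul] at h2
    exact h2

theorem norm_amplify_le (e : Y × Z ≃ X) (T : EllTwo Y →L[ℂ] EllTwo Y) : ‖amplify e T‖ ≤ ‖T‖ :=
  ContinuousLinearMap.opNorm_le_bound _ (norm_nonneg T) fun f =>
    norm_le_of_sum_sq_le (by positivity) (sum_sq_amplify_le e T f)

theorem continuous_amplify (e : Y × Z ≃ X) : Continuous (amplify e) :=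
  AddMonoidHomClass.continuous_of_bound (amplify e) 1 fun T => by
    rw [one_mul]; exact norm_amplify_le e T

end EllTwoOperators

/-! ### Minimal projections in algebras containing compact operators -/

section MinimalProjections

variable {D : Type u} [NonUnitalCStarAlgebra D] {H : Type v} [NormedAddCommGroup H]
  [InnerProductSpace ℂ H] [CompleteSpace H]

/-- The range of an operator representing `x`. -/
def repRange (π : D →⋆ₙₐ[ℂ] (H →L[ℂ] H)) (x : D) : Submodule ℂ H :=
  LinearMap.range (π x : H →ₗ[ℂ] H)

theorem repRange_mul_le (π : D →⋆ₙₐ[ℂ] (H →L[ℂ] H)) (x y : D) :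
    repRange π (x * y) ≤ repRange π x := by
  rintro _ ⟨v, rfl⟩
  rw [map_mul]
  exact ⟨π y v, rfl⟩

theorem repRange_smul {π : D →⋆ₙₐ[ℂ] (H →L[ℂ] H)} {c : ℂ} (hc : c ≠ 0) (x : D) :
    repRange π (c • x) = repRange π x := by
  rw [repRange, map_smul]
  exact LinearMap.range_smul _ _ hc

theorem eq_zero_of_cfcₙ_eq_zero {h : D} (hh : IsSelfAdjoint h) {f : ℝ → ℝ} (hf : Continuous f)
    (hf0 : f 0 = 0) (h0 : cfcₙ f h = 0) {x : ℝ} (hx : x ∈ quasispectrum ℝ h) : f x = 0 := by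
  have h1 : cfcₙ f h = cfcₙ (fun _ : ℝ => (0 : ℝ)) h := by
    rw [h0]; exact (cfcₙ_const_zero ℝ h).symm
  exact (cfcₙ_eq_cfcₙ_iff_eqOn hh (hf := hf.continuousOn) (hf0 := hf0)).1 h1 hx

theorem exists_mem_quasispectrum_ne_zero {h : D} (hh : IsSelfAdjoint h) (h0 : h ≠ 0) :
    ∃ x ∈ quasispectrum ℝ h, x ≠ 0 := by
  by_contra! hcon
  apply h0
  rw [← cfcₙ_id ℝ h]
  exact (cfcₙ_congr (f := id) (g := fun _ => (0 : ℝ)) fun x hx => hcon x hx).trans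
    (cfcₙ_const_zero ℝ h)

/-- Cut the spectrum of `d* d` away from `0` by functional calculus. The cut-off element has its
range in the `1`-eigenspace of a compact operator, which is finite dimensional. -/
theorem exists_isSelfAdjoint_finiteDimensional_repRange {π : D →⋆ₙₐ[ℂ] (H →L[ℂ] H)} {d : D}
    (hd : d ≠ 0) (hc : IsCompactOperator (π d)) :
    ∃ g : D, IsSelfAdjoint g ∧ g ≠ 0 ∧ FiniteDimensional ℂ (repRange π g) := by
  set h := star d * d with hh
  have hsa : IsSelfAdjoint h := IsSelfAdjoint.star_mul_self d
  have hne : h ≠ 0 := by rwa [hh, Ne, CStarRing.star_mul_self_eq_zero_iff]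
  have hcomp : IsCompactOperator (π h) := by
    rw [hh, map_mul]
    exact hc.clm_comp _
  obtain ⟨l, hl, hl0⟩ := exists_mem_quasispectrum_ne_zero hsa hne
  -- Half of `|l|`, so that the cut-off `f` below does not vanish at the spectral point `l`.
  set δ := |l| / 2 with hδ
  have hδ0 : 0 < δ := by positivity
  set f : ℝ → ℝ := fun x => max (|x| - δ) 0 with hf
  -- A continuous function vanishing at `0` that equals `1/x` for `|x| ≥ δ`, so `w(x) x = 1`
  -- wherever `f` is nonzero.
  set w : ℝ → ℝ := fun x => x / max (x ^ 2) (δ ^ 2) with hw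
  have hfc : Continuous f := by fun_prop
  have hden : ∀ x : ℝ, max (x ^ 2) (δ ^ 2) ≠ 0 := fun x =>
    (lt_of_lt_of_le (by positivity) (le_max_right (x ^ 2) (δ ^ 2))).ne'
  have hwc : Continuous w := by
    refine Continuous.div continuous_id (by fun_prop) hden
  have hf0 : f 0 = 0 := by simp [hf, hδ0.le]
  have hw0 : w 0 = 0 := by simp [hw]
  have hkey : ∀ x, w x * x * f x = f x := by
    intro x
    by_cases hx : |x| ≤ δ
    · simp [hf, hx]
    · have h1 : δ ^ 2 ≤ x ^ 2 := by
        rw [← sq_abs x]; exact pow_le_pow_left₀ hδ0.le (not_le.1 hx).le 2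
      have h2 : x ≠ 0 := by rintro rfl; simp [hδ0.le] at hx
      have h3 : w x * x = 1 := by
        simp only [hw, max_eq_left h1]; field_simp
      rw [h3, one_mul]
  refine ⟨cfcₙ f h, cfcₙ_predicate f h, ?_, ?_⟩
  · intro h0
    have := eq_zero_of_cfcₙ_eq_zero hsa hfc hf0 h0 hl
    have h1 : f l = |l| / 2 := by
      simp only [hf, hδ]; rw [max_eq_left (by linarith [abs_nonneg l])]; ring
    rw [h1] at this
    exact hl0 (by simpa using this)
  · set C := cfcₙ w h * h with hC
    have hCf : C * cfcₙ f h = cfcₙ f h := by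
      have e1 : C = cfcₙ (fun x => w x * x) h := by
        rw [hC, cfcₙ_mul w (fun x => x) h hwc.continuousOn hw0 continuousOn_id rfl]
        rw [cfcₙ_id' ℝ h]
      rw [e1, ← cfcₙ_mul (fun x => w x * x) f h (by fun_prop) (by simp) hfc.continuousOn hf0]
      exact congrArg (fun k => cfcₙ k h) (funext hkey)
    have hCc : IsCompactOperator (π C) := by
      rw [hC, map_mul]
      exact hcomp.clm_comp _
    have hfin := ContinuousLinearMap.finite_dimensional_eigenspace hCc 1 one_ne_zero
    refine Submodule.finiteDimensional_of_le (S₂ := Module.End.eigenspace (π C).toLinearMap 1) ?_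
    rintro _ ⟨v, rfl⟩
    rw [Module.End.mem_eigenspace_iff, one_smul]
    change (π C * π (cfcₙ f h)) v = _
    rw [← map_mul, hCf]
    rfl

/-- A self-adjoint element whose range has the least possible nonzero dimension is a multiple of
a projection. -/
theorem mul_self_eq_smul_of_minimal {π : D →⋆ₙₐ[ℂ] (H →L[ℂ] H)} (hπ : Function.Injective π)
    {g : D} (hg : IsSelfAdjoint g) (hg0 : g ≠ 0) (hfin : FiniteDimensional ℂ (repRange π g))
    (hmin : ∀ x : D, IsSelfAdjoint x → x ≠ 0 → FiniteDimensional ℂ (repRange π x) →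
      Module.finrank ℂ (repRange π g) ≤ Module.finrank ℂ (repRange π x)) :
    ∃ l : ℝ, l ≠ 0 ∧ g * g = l • g := by
  obtain ⟨l, hl, hl0⟩ := exists_mem_quasispectrum_ne_zero hg hg0
  refine ⟨l, hl0, ?_⟩
  have huniq : ∀ m ∈ quasispectrum ℝ g, m ≠ 0 → m = l := by
    intro m hm hm0
    by_contra hne
    -- `φ a b` lives on the points closer to `a` than to `b`, apart from `0`, so `φ l m` and `φ m l`
    -- have product zero. Two distinct nonzero spectral values would thus give nonzero `x, y` with
    -- `x * y = 0` and ranges inside that of `g`.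
    set φ : ℝ → ℝ → ℝ → ℝ := fun a b x => x * max (|x - b| - |x - a|) 0 with hφ
    have hφc : ∀ a b, Continuous (φ a b) := fun a b => by fun_prop
    have hφ0 : ∀ a b, φ a b 0 = 0 := fun a b => by simp [hφ]
    have hsmul : ∀ a b, cfcₙ (fun x => x * φ a b x) g = g * cfcₙ (φ a b) g := by
      intro a b
      rw [cfcₙ_mul (fun x => x) (φ a b) g continuousOn_id rfl (hφc a b).continuousOn (hφ0 a b),
        cfcₙ_id' ℝ g]
    have hle : ∀ a b, repRange π (cfcₙ (fun x => x * φ a b x) g) ≤ repRange π g := by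
      intro a b
      rw [hsmul]
      exact repRange_mul_le _ _ _
    have hne0 : ∀ a b, a ∈ quasispectrum ℝ g → a ≠ 0 → a ≠ b →
        cfcₙ (fun x => x * φ a b x) g ≠ 0 := by
      intro a b ha ha0 hab h0
      have h1 := eq_zero_of_cfcₙ_eq_zero hg (f := fun x => x * φ a b x)
        (continuous_id.mul (hφc a b)) (by simp) h0 ha
      have h2 : 0 < |a - b| := abs_pos.2 (sub_ne_zero.2 hab)
      simp [hφ, ha0, sub_eq_zero, hab] at h1
    set x := cfcₙ (fun x => x * φ l m x) g with hx
    set y := cfcₙ (fun x => x * φ m l x) g with hy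
    have hxy : x * y = 0 := by
      rw [hx, hy, ← cfcₙ_mul (fun x => x * φ l m x) (fun x => x * φ m l x) g
        (continuous_id.mul (hφc l m)).continuousOn (by simp)
        (continuous_id.mul (hφc m l)).continuousOn (by simp)]
      refine (congrArg (fun k => cfcₙ k g) (funext fun t => ?_)).trans (cfcₙ_const_zero ℝ g)
      simp only [hφ]
      rcases le_total |t - m| |t - l| with h | h <;> simp [h]
    have hxsa : IsSelfAdjoint x := cfcₙ_predicate _ g
    have hx0 : x ≠ 0 := hne0 l m hl hl0 (Ne.symm hne)
    have hy0 : y ≠ 0 := hne0 m l hm hm0 hne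
    have hxfin : FiniteDimensional ℂ (repRange π x) := Submodule.finiteDimensional_of_le (hle l m)
    -- Minimality forces the range of `x` to be all of the range of `g`, which contains the range of
    -- `y`. As `x` is self-adjoint and `x * y = 0`, the two ranges are orthogonal, so `y = 0`.
    have hxg : repRange π x = repRange π g :=
      Submodule.eq_of_le_of_finrank_le (hle l m) (hmin x hxsa hx0 hxfin)
    apply hy0
    apply hπ
    rw [map_zero]
    ext1 v
    have hv : π y v ∈ repRange π x := hxg ▸ hle m l ⟨v, rfl⟩
    obtain ⟨z, hz⟩ := hv
    have hz' : π x z = π y v := hz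
    have h1 : inner ℂ (π y v) (π y v) = 0 := by
      nth_rewrite 1 [← hz']
      have h2 : π x = ContinuousLinearMap.adjoint (π x) := by
        rw [← ContinuousLinearMap.star_eq_adjoint, ← map_star, hxsa.star_eq]
      rw [h2, ContinuousLinearMap.adjoint_inner_left]
      have h3 : π x (π y v) = 0 := by
        change (π x * π y) v = 0
        rw [← map_mul, hxy, map_zero]
        rfl
      rw [h3, inner_zero_right]
    exact inner_self_eq_zero.1 h1
  have e1 : g * g = cfcₙ (fun x : ℝ => x * x) g := by
    rw [cfcₙ_mul (fun x : ℝ => x) (fun x => x) g, cfcₙ_id' ℝ g]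
  have e2 : l • g = cfcₙ (fun x : ℝ => l * x) g := by
    have := cfcₙ_const_mul l (fun x : ℝ => x) g
    rw [this, cfcₙ_id' ℝ g]
  rw [e1, e2]
  refine cfcₙ_congr fun x hx => ?_
  by_cases h0 : x = 0
  · simp [h0]
  · rw [huniq x hx h0]

/-- If a faithful representation of a `C*`-algebra maps a nonzero element to a compact operator,
then the algebra has a minimal projection. -/
theorem exists_isMinimalProjection {π : D →⋆ₙₐ[ℂ] (H →L[ℂ] H)} (hπ : Function.Injective π)
    {d : D} (hd : d ≠ 0) (hc : IsCompactOperator (π d)) : ∃ p : D, IsMinimalProjection p := by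
  set S : Set D := {g | IsSelfAdjoint g ∧ g ≠ 0 ∧ FiniteDimensional ℂ (repRange π g)} with hS
  obtain ⟨g, ⟨hg, hg0, hfin⟩, hmin'⟩ :=
    (measure fun x : D => Module.finrank ℂ (repRange π x)).wf.has_min S
      (exists_isSelfAdjoint_finiteDimensional_repRange hd hc)
  have hmin : ∀ x : D, IsSelfAdjoint x → x ≠ 0 → FiniteDimensional ℂ (repRange π x) →
      Module.finrank ℂ (repRange π g) ≤ Module.finrank ℂ (repRange π x) :=
    fun x h1 h2 h3 => not_lt.1 (hmin' x ⟨h1, h2, h3⟩)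
  -- By minimality of the rank, a nonzero self-adjoint element whose range lies in that of `g` has
  -- the same range, and it also has least rank, so it is a multiple of a projection.
  have normalize : ∀ x : D, IsSelfAdjoint x → x ≠ 0 → repRange π x ≤ repRange π g →
      ∃ c : ℂ, c ≠ 0 ∧ IsStarProjection (c⁻¹ • x) ∧ repRange π (c⁻¹ • x) = repRange π g := by
    intro x hx hx0 hle
    have hxfin : FiniteDimensional ℂ (repRange π x) := Submodule.finiteDimensional_of_le hle
    have hxg : repRange π x = repRange π g :=
      Submodule.eq_of_le_of_finrank_le hle (hmin x hx hx0 hxfin)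
    obtain ⟨l, hl0, hl⟩ := mul_self_eq_smul_of_minimal hπ hx hx0 hxfin
      (fun y h1 h2 h3 => hxg ▸ hmin y h1 h2 h3)
    have hlc : (l : ℂ) ≠ 0 := by exact_mod_cast hl0
    refine ⟨l, hlc, ⟨?_, ?_⟩, ?_⟩
    · rw [IsIdempotentElem, smul_mul_smul_comm, hl, ← Complex.coe_smul, smul_smul]
      congr 1
      field_simp
    · rw [IsSelfAdjoint, star_smul, hx.star_eq]
      simp
    · rw [repRange_smul (inv_ne_zero hlc), hxg]
  obtain ⟨c, hc0, hp, hpr⟩ := normalize g hg hg0 le_rfl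
  set p := c⁻¹ • g with hpdef
  have hsacorner : ∀ a : D, IsSelfAdjoint a → ∃ k : ℂ, p * a * p = k • p := by
    intro a ha
    by_cases h0 : p * a * p = 0
    · exact ⟨0, by rw [h0, zero_smul]⟩
    have hsa : IsSelfAdjoint (p * a * p) := by
      rw [IsSelfAdjoint, star_mul, star_mul, hp.isSelfAdjoint.star_eq, ha.star_eq, mul_assoc]
    obtain ⟨k, hk0, hq, hqr⟩ := normalize (p * a * p) hsa h0
      (by rw [mul_assoc, ← hpr]; exact repRange_mul_le _ _ _)
    refine ⟨k, ?_⟩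
    set q := k⁻¹ • (p * a * p) with hqdef
    have hqp : q * p = q := by
      rw [hqdef, smul_mul_assoc, mul_assoc (p * a), hp.isIdempotentElem.eq]
    -- `q` is a projection with the same range as `p`, so it fixes that range pointwise. Together
    -- with `q * p = q` this gives `q = p`.
    have hqp' : q * p = p := by
      apply hπ
      rw [map_mul]
      ext1 v
      have hv : π p v ∈ repRange π q := by rw [hqr, ← hpr]; exact ⟨v, rfl⟩
      obtain ⟨z, hz⟩ := hv
      have hz' : π q z = π p v := hz
      change π q (π p v) = π p v
      rw [← hz']
      change (π q * π q) z = π q z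
      rw [← map_mul, hq.isIdempotentElem.eq]
    calc p * a * p = k • q := by rw [hqdef, smul_smul, mul_inv_cancel₀ hk0, one_smul]
      _ = k • p := by rw [hqp.symm.trans hqp']
  refine ⟨p, hp, smul_ne_zero (inv_ne_zero hc0) hg0, fun a => ?_⟩
  clear_value p
  obtain ⟨k₁, h₁⟩ := hsacorner (realPart a) (realPart a).2
  obtain ⟨k₂, h₂⟩ := hsacorner (imaginaryPart a) (imaginaryPart a).2
  refine ⟨k₁ + Complex.I * k₂, ?_⟩
  conv_lhs => rw [← realPart_add_I_smul_imaginaryPart a]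
  rw [mul_add, add_mul, h₁, mul_smul_comm, smul_mul_assoc, h₂, add_smul, smul_smul]

end MinimalProjections

/-! ### Homomorphisms out of quotients -/

namespace ClosedIdeal

variable {A : Type u} [NonUnitalCStarAlgebra A] (I : ClosedIdeal A)
  {B : Type v} [NonUnitalCStarAlgebra B]

theorem continuous_cls : Continuous I.cls := I.sub.continuous_mkQ

/-- The `*`-homomorphism on `A / I` induced by one on `A` that vanishes on `I`. -/
def liftHom (f : A →⋆ₙₐ[ℂ] B) (hf : ∀ a ∈ I.carrier, f a = 0) : I.QuotientAlg →⋆ₙₐ[ℂ] B where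
  toFun := Quotient.lift f fun a b hab => by
    have hab' : a - b ∈ I.carrier := (Submodule.quotientRel_def I.sub).1 hab
    have := hf _ hab'
    rwa [map_sub, sub_eq_zero] at this
  map_smul' c x := by
    obtain ⟨a, rfl⟩ := I.cls_surjective x
    exact map_smul f c a
  map_zero' := map_zero f
  map_add' x y := by
    obtain ⟨a, rfl⟩ := I.cls_surjective x
    obtain ⟨b, rfl⟩ := I.cls_surjective y
    exact map_add f a b
  map_mul' x y := by
    obtain ⟨a, rfl⟩ := I.cls_surjective x
    obtain ⟨b, rfl⟩ := I.cls_surjective y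
    exact map_mul f a b
  map_star' x := by
    obtain ⟨a, rfl⟩ := I.cls_surjective x
    exact map_star f a

theorem continuous_liftHom (f : A →⋆ₙₐ[ℂ] B) (hf : ∀ a ∈ I.carrier, f a = 0) :
    Continuous (I.liftHom f hf) := by
  refine (Submodule.isQuotientMap_mkQ (S := I.sub)).continuous_iff.2 ?_
  exact AddMonoidHomClass.continuous_of_bound f 1 fun a => by
    rw [one_mul]; exact NonUnitalStarAlgHom.norm_apply_le f a

end ClosedIdeal

/-! ### Composition series with compact layers: Cantor–Bendixson sequence and scatteredness. -/

theorem compactOps_mem_closure_span {X : Type u} (k : compactOps (EllTwo X)) :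
    k ∈ closure (Submodule.span ℂ {T : compactOps (EllTwo X) |
      ∃ s t : X, (T : EllTwo X →L[ℂ] EllTwo X) = matrixUnit s t} : Set (compactOps (EllTwo X))) := by
  rw [Topology.IsInducing.subtypeVal.closure_eq_preimage_closure_image, Set.mem_preimage]
  have h := mem_closure_span_matrixUnit k.2
  rw [← SetLike.mem_coe, Submodule.topologicalClosure_coe] at h
  convert h using 2
  change ((compactOps (EllTwo X)).toNonUnitalSubalgebra.toSubmodule.subtype : _ → _) '' _ = _
  rw [← Submodule.map_coe, Submodule.map_span]
  congr 2
  ext T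
  constructor
  · rintro ⟨k, ⟨s, t, hk⟩, rfl⟩
    exact ⟨s, t, hk⟩
  · rintro ⟨s, t, rfl⟩
    exact ⟨⟨matrixUnit s t, matrixUnit_mem_compactOps s t⟩, ⟨s, t, rfl⟩, rfl⟩

theorem rankOne_mul_mul_rankOne {H : Type u} [NormedAddCommGroup H] [InnerProductSpace ℂ H]
    (v : H) (T : H →L[ℂ] H) :
    InnerProductSpace.rankOne ℂ v v * T * InnerProductSpace.rankOne ℂ v v =
      inner ℂ v (T v) • InnerProductSpace.rankOne ℂ v v := by
  ext1 f
  change InnerProductSpace.rankOne ℂ v v (T (InnerProductSpace.rankOne ℂ v v f)) = _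
  simp [smul_smul, mul_comm]

/-- A chain of ideals of a `C*`-algebra together with representations showing that consecutive
quotients are essential ideals isomorphic to the compact operators on `ℓ₂(ι)`. -/
structure CompositionSeries (A : Type u) [NonUnitalCStarAlgebra A] (θ : Ordinal.{u})
    (ι : Type u) where
  ideal : Ordinal.{u} → ClosedIdeal A
  ideal_zero : (ideal 0).carrier = {0}
  mono : ∀ α β, α ≤ β → β ≤ θ → (ideal α).carrier ⊆ (ideal β).carrier
  limit : ∀ γ, γ ≤ θ → Order.IsSuccLimit γ →
    (ideal γ).carrier = closure (⋃ α ∈ Set.Iio γ, (ideal α).carrier)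
  ideal_top : (ideal θ).carrier = Set.univ
  rep : ∀ α, α < θ → A →⋆ₙₐ[ℂ] (EllTwo ι →L[ℂ] EllTwo ι)
  rep_eq_zero_iff : ∀ α (hα : α < θ) a, rep α hα a = 0 ↔ a ∈ (ideal α).carrier
  isCompactOperator_rep_iff : ∀ α (hα : α < θ) a,
    IsCompactOperator (rep α hα a) ↔ a ∈ (ideal (Order.succ α)).carrier
  sec : ∀ α, α < θ → compactOps (EllTwo ι) →⋆ₙₐ[ℂ] A
  continuous_sec : ∀ α (hα : α < θ), Continuous (sec α hα)
  rep_sec : ∀ α (hα : α < θ) k, rep α hα (sec α hα k) = k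

namespace CompositionSeries

variable {A : Type u} [NonUnitalCStarAlgebra A] {θ : Ordinal.{u}} {ι : Type u}
  (C : CompositionSeries A θ ι) {α : Ordinal.{u}} (hα : α < θ)

/-- The faithful representation of `A / I_α` induced by the `α`-th representation. -/
def quotRep : (C.ideal α).QuotientAlg →⋆ₙₐ[ℂ] (EllTwo ι →L[ℂ] EllTwo ι) :=
  (C.ideal α).liftHom (C.rep α hα) fun a ha => (C.rep_eq_zero_iff α hα a).2 ha

theorem quotRep_cls (a : A) : C.quotRep hα ((C.ideal α).cls a) = C.rep α hα a := rfl

theorem quotRep_injective : Function.Injective (C.quotRep hα) := by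
  intro x y hxy
  obtain ⟨a, rfl⟩ := (C.ideal α).cls_surjective x
  obtain ⟨b, rfl⟩ := (C.ideal α).cls_surjective y
  rw [quotRep_cls, quotRep_cls, ← sub_eq_zero, ← map_sub, C.rep_eq_zero_iff] at hxy
  exact (C.ideal α).cls_eq_cls_iff.2 hxy

/-- The copy of the compact operators inside `A / I_α`. -/
def quotSec : compactOps (EllTwo ι) →⋆ₙₐ[ℂ] (C.ideal α).QuotientAlg :=
  (C.ideal α).mkHom.comp (C.sec α hα)

theorem quotRep_quotSec (k : compactOps (EllTwo ι)) : C.quotRep hα (C.quotSec hα k) = k :=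
  C.rep_sec α hα k

theorem continuous_quotSec : Continuous (C.quotSec hα) :=
  (C.ideal α).continuous_cls.comp (C.continuous_sec α hα)

/-- Describes the layer through the representation alone; closedness of the layer then follows from
continuity of `quotRep`. -/
theorem cls_image_eq : (C.ideal α).cls '' (C.ideal (Order.succ α)).carrier =
    {q | IsCompactOperator (C.quotRep hα q)} := by
  ext q
  obtain ⟨a, rfl⟩ := (C.ideal α).cls_surjective q
  rw [Set.mem_ofPred_eq, quotRep_cls, C.isCompactOperator_rep_iff]
  refine ⟨?_, fun h => ⟨a, h, rfl⟩⟩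
  rintro ⟨b, hb, hab⟩
  rw [← C.isCompactOperator_rep_iff α hα] at hb ⊢
  rwa [← quotRep_cls, ← hab, quotRep_cls]

theorem isMinimalProjection_of_quotRep_eq {q : (C.ideal α).QuotientAlg} {v : EllTwo ι}
    (hv : ‖v‖ = 1) (hq : C.quotRep hα q = InnerProductSpace.rankOne ℂ v v) :
    IsMinimalProjection q := by
  have hp := InnerProductSpace.isStarProjection_rankOne_self (𝕜 := ℂ) hv
  refine ⟨⟨?_, ?_⟩, ?_, fun a => ⟨inner ℂ v (C.quotRep hα a v), ?_⟩⟩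
  · apply C.quotRep_injective hα
    rw [map_mul, hq]
    exact hp.isIdempotentElem
  · apply C.quotRep_injective hα
    rw [map_star, hq]
    exact hp.isSelfAdjoint
  · rintro rfl
    rw [map_zero] at hq
    have : v ≠ 0 := by rintro rfl; simp at hv
    simpa [this] using hq.symm
  · apply C.quotRep_injective hα
    rw [map_smul, map_mul, map_mul, hq, rankOne_mul_mul_rankOne]

/-- Diagonal matrix units are minimal projections. An off-diagonal one is recovered by compressing
the rank-one projection onto `e_s + e_t` between two diagonal ones. -/
theorem quotSec_matrixUnit_mem (s t : ι) (k : compactOps (EllTwo ι))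
    (hk : (k : EllTwo ι →L[ℂ] EllTwo ι) = matrixUnit s t) :
    C.quotSec hα k ∈ NonUnitalStarAlgebra.adjoin ℂ
      {p : (C.ideal α).QuotientAlg | IsMinimalProjection p} := by
  set N := NonUnitalStarAlgebra.adjoin ℂ {p : (C.ideal α).QuotientAlg | IsMinimalProjection p}
  have hdiag : ∀ (x : ι) (k : compactOps (EllTwo ι)),
      (k : EllTwo ι →L[ℂ] EllTwo ι) = matrixUnit x x → C.quotSec hα k ∈ N := by
    intro x k hk
    refine NonUnitalStarAlgebra.subset_adjoin ℂ _ ?_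
    exact C.isMinimalProjection_of_quotRep_eq hα (norm_stdVec x)
      (by rw [quotRep_quotSec, hk, matrixUnit_eq_rankOne])
  by_cases hst : s = t
  · subst hst
    exact hdiag s k hk
  set w : EllTwo ι := stdVec s + stdVec t with hw
  have hw0 : w ≠ 0 := by
    intro h0
    have h1 : w s = 0 := by rw [h0]; rfl
    rw [hw, ellTwo_add_apply, stdVec_self] at h1
    classical
    rw [stdVec_apply, if_neg hst] at h1
    simp at h1
  set v : EllTwo ι := ((‖w‖ : ℂ)⁻¹) • w with hv
  have hv1 : ‖v‖ = 1 := by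
    rw [hv, norm_smul]
    simp [hw0]
  set P : compactOps (EllTwo ι) :=
    ⟨InnerProductSpace.rankOne ℂ v v, isCompactOperator_rankOne v v⟩
  have hP : C.quotSec hα P ∈ N := NonUnitalStarAlgebra.subset_adjoin ℂ _
    (C.isMinimalProjection_of_quotRep_eq hα hv1 (quotRep_quotSec _ _ _))
  set E : ι → compactOps (EllTwo ι) := fun x => ⟨matrixUnit x x, matrixUnit_mem_compactOps x x⟩
  -- The factor `‖w‖ ^ 2` undoes the normalisation of `w`: the `(s, t)` entry of `P` is `‖w‖ ^
  -- (-2)`.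
  have hEP : k = ((‖w‖ : ℂ) ^ 2) • (E s * P * E t) := by
    have hvs : v s = (‖w‖ : ℂ)⁻¹ := by
      classical
      rw [hv, ellTwo_smul_apply, hw, ellTwo_add_apply, stdVec_self, stdVec_apply, if_neg hst]
      simp
    have hvt : v t = (‖w‖ : ℂ)⁻¹ := by
      classical
      rw [hv, ellTwo_smul_apply, hw, ellTwo_add_apply, stdVec_self, stdVec_apply,
        if_neg (Ne.symm hst)]
      simp
    refine Subtype.ext ?_
    rw [hk]
    ext1 f
    change _ = ((‖w‖ : ℂ) ^ 2) • matrixUnit s s (InnerProductSpace.rankOne ℂ v v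
      (matrixUnit t t f))
    have hw0' : (‖w‖ : ℂ) ≠ 0 := by simpa using hw0
    rw [InnerProductSpace.rankOne_apply, matrixUnit_apply, matrixUnit_apply, matrixUnit_apply,
      inner_smul_right, inner_stdVec_right, ellTwo_smul_apply, hvs, hvt, smul_smul]
    congr 1
    simp
    field_simp
  rw [hEP, map_smul (C.quotSec hα) ((‖w‖ : ℂ) ^ 2) (E s * P * E t), map_mul, map_mul]
  exact N.smul_mem _ (N.mul_mem (N.mul_mem (hdiag s _ rfl) hP) (hdiag t _ rfl))

/-- A minimal projection is represented by a nonzero `P`, and compressing a diagonal matrix unit by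
`P` gives a multiple of `P`. If the multiple is nonzero, `P` is compact. Conversely, compact
operators are limits of combinations of matrix units, which the minimal projections generate. -/
theorem atomIdeal_quotient (C : CompositionSeries A θ ι) (hα : α < θ) :
    atomIdeal (C.ideal α).QuotientAlg =
      (C.ideal α).cls '' (C.ideal (Order.succ α)).carrier := by
  refine Set.Subset.antisymm ?_ ?_
  · refine closure_minimal ?_ ?_
    · have hle : NonUnitalStarAlgebra.adjoin ℂ
          {p : (C.ideal α).QuotientAlg | IsMinimalProjection p} ≤
          (C.ideal (Order.succ α)).subquotient (C.ideal α) := by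
        refine NonUnitalStarAlgebra.adjoin_le fun p hp => ?_
        change p ∈ (C.ideal α).cls '' (C.ideal (Order.succ α)).carrier
        rw [C.cls_image_eq hα, Set.mem_ofPred_eq]
        set P := C.quotRep hα p with hP
        have hP0 : P ≠ 0 := fun h => hp.ne_zero (C.quotRep_injective hα (h.trans (map_zero _).symm))
        have hPs : star P = P := by
          rw [hP, ← map_star, hp.isStarProjection.isSelfAdjoint.star_eq]
        obtain ⟨s, hs⟩ : ∃ s, P (stdVec s) ≠ 0 := by
          by_contra! hcon
          exact hP0 (clm_ext_stdVec fun x => by rw [hcon x]; rfl)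
        set k : compactOps (EllTwo ι) := ⟨matrixUnit s s, matrixUnit_mem_compactOps s s⟩
        obtain ⟨c, hc⟩ := hp.corner (C.quotSec hα k)
        have hc' : P * matrixUnit s s * P = c • P := by
          have := congrArg (C.quotRep hα) hc
          rwa [map_mul, map_mul, quotRep_quotSec, map_smul] at this
        have hne : matrixUnit s s * P ≠ 0 := by
          intro h0
          have h1 := congrArg star h0
          rw [star_mul, star_zero, star_matrixUnit, hPs] at h1
          have h2 := congrArg (fun T : EllTwo ι →L[ℂ] EllTwo ι => T (stdVec s)) h1
          apply hs
          have h3 : P (matrixUnit s s (stdVec s)) = 0 := h2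
          rwa [matrixUnit_apply, stdVec_self, one_smul] at h3
        -- If `c = 0`, then `(e_ss P)* (e_ss P) = P e_ss P = 0`, contradicting `e_ss P ≠ 0`.
        have hc0 : c ≠ 0 := by
          rintro rfl
          apply hne
          rw [← CStarRing.star_mul_self_eq_zero_iff, star_mul, star_matrixUnit, hPs, mul_assoc,
            ← mul_assoc (matrixUnit s s), matrixUnit_mul_matrixUnit, ← mul_assoc, hc', zero_smul]
        have hPc : P = c⁻¹ • (P * matrixUnit s s * P) := by
          rw [hc', smul_smul, inv_mul_cancel₀ hc0, one_smul]
        rw [hPc]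
        exact (((isCompactOperator_matrixUnit s s).clm_comp P).comp_clm P).smul c⁻¹
      exact hle
    · rw [C.cls_image_eq hα]
      exact (isClosed_compactOps (EllTwo ι)).preimage ((C.ideal α).continuous_liftHom _ _)
  · rw [C.cls_image_eq hα]
    intro q hq
    have hqs : q = C.quotSec hα ⟨C.quotRep hα q, hq⟩ :=
      C.quotRep_injective hα (C.quotRep_quotSec hα ⟨C.quotRep hα q, hq⟩).symm
    rw [hqs]
    refine map_mem_closure (C.continuous_quotSec hα) (compactOps_mem_closure_span _) ?_
    intro k hk
    set N := NonUnitalStarAlgebra.adjoin ℂ {p : (C.ideal α).QuotientAlg | IsMinimalProjection p}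
    change C.quotSec hα k ∈ N
    induction hk using Submodule.span_induction with
    | mem x h => obtain ⟨s, t, h⟩ := h; exact C.quotSec_matrixUnit_mem hα s t x h
    | zero => rw [map_zero]; exact N.zero_mem
    | add x y _ _ hx hy => rw [map_add]; exact N.add_mem hx hy
    | smul c x _ hx => rw [map_smul]; exact N.smul_mem c hx

/-- The Cantor–Bendixson sequence given by a composition series. -/
def cantorBendixson [Nonempty ι] : CantorBendixson A where
  height := θ
  ideal := C.ideal
  ideal_zero := C.ideal_zero
  mono := C.mono
  limit := C.limit
  succ _ hα := C.atomIdeal_quotient hα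
  ideal_height := C.ideal_top
  ne_univ α hα h := by
    obtain ⟨s⟩ := ‹Nonempty ι›
    have h1 : C.sec α hα ⟨matrixUnit s s, matrixUnit_mem_compactOps s s⟩ ∈ (C.ideal α).carrier := by
      rw [h]; exact Set.mem_univ _
    rw [← C.rep_eq_zero_iff α hα, C.rep_sec] at h1
    exact matrixUnit_ne_zero s s h1

/-- The layers of the Cantor–Bendixson sequence are the compact operators. -/
def layerEquiv [Nonempty ι] : C.cantorBendixson.layer α ≃⋆ₐ[ℂ] compactOps (EllTwo ι) where
  toFun q := ⟨C.quotRep hα q.1, by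
    have h : (q.1 : (C.ideal α).QuotientAlg) ∈
      (C.ideal α).cls '' (C.ideal (Order.succ α)).carrier := q.2
    rw [C.cls_image_eq hα] at h
    exact h⟩
  invFun k := ⟨C.quotSec hα k, by
    change C.quotSec hα k ∈ (C.ideal α).cls '' (C.ideal (Order.succ α)).carrier
    rw [C.cls_image_eq hα, Set.mem_ofPred_eq, quotRep_quotSec]
    exact k.2⟩
  left_inv q := Subtype.ext (C.quotRep_injective hα (quotRep_quotSec _ _ _))
  right_inv k := Subtype.ext (quotRep_quotSec _ _ _)
  map_mul' x y := Subtype.ext (map_mul (C.quotRep hα) x.1 y.1)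
  map_add' x y := Subtype.ext (map_add (C.quotRep hα) x.1 y.1)
  map_star' x := Subtype.ext (map_star (C.quotRep hα) x.1)
  map_smul' c x := Subtype.ext (map_smul (C.quotRep hα) c x.1)

/-- Take the least `γ` for which the subalgebra `D` meets the `γ`-th ideal nontrivially. For `β < γ`
the `β`-th representation is faithful on `D`; when `γ = β + 1` it sends some nonzero element of `D`
to a compact operator. -/
theorem isScattered (C : CompositionSeries A θ ι) : IsScattered A := by
  intro D hD hD0
  have : IsClosed (D : Set A) := hD
  set S : Set Ordinal.{u} := {α | α ≤ θ ∧ ∃ d ∈ D, d ≠ 0 ∧ d ∈ (C.ideal α).carrier} with hS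
  have hSne : S.Nonempty := by
    obtain ⟨d, hd, hd0⟩ : ∃ d ∈ D, d ≠ 0 := by
      by_contra! hcon
      exact hD0 (eq_bot_iff.2 fun d hd => NonUnitalStarAlgebra.mem_bot.2 (hcon d hd))
    exact ⟨θ, le_rfl, d, hd, hd0, by rw [C.ideal_top]; exact Set.mem_univ _⟩
  have hmem := csInf_mem hSne
  have hmin : ∀ β ∈ S, sInf S ≤ β := fun β hβ => csInf_le' hβ
  generalize sInf S = γ at hmem hmin
  obtain ⟨hγ, d, hd, hd0, hdγ⟩ := hmem
  have hinj : ∀ β (hβ : β < θ), β < γ →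
      Function.Injective ((C.rep β hβ).comp (NonUnitalStarSubalgebraClass.subtype D)) := by
    intro β hβ hβγ
    rw [injective_iff_map_eq_zero]
    intro x hx
    by_contra hx0
    refine absurd (hmin β ⟨hβ.le, x, x.2, fun h => hx0 (Subtype.ext h), ?_⟩) (not_le.2 hβγ)
    exact (C.rep_eq_zero_iff β hβ _).1 hx
  rcases Ordinal.zero_or_succ_or_isSuccLimit γ with h | ⟨β, h⟩ | h
  · subst h
    rw [C.ideal_zero] at hdγ
    exact absurd hdγ hd0
  · have hβγ : β < γ := by rw [← h]; exact Order.lt_succ β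
    have hβ : β < θ := hβγ.trans_le hγ
    have hdc : IsCompactOperator
        ((C.rep β hβ).comp (NonUnitalStarSubalgebraClass.subtype D) ⟨d, hd⟩) := by
      refine (C.isCompactOperator_rep_iff β hβ d).2 ?_
      rwa [h]
    obtain ⟨p, hp⟩ := exists_isMinimalProjection (hinj β hβ hβγ)
      (d := ⟨d, hd⟩) (fun h0 => hd0 (congrArg Subtype.val h0)) hdc
    exact ⟨p, subset_closure (NonUnitalStarAlgebra.subset_adjoin ℂ _ hp), hp.ne_zero⟩
  -- The limit case is impossible. Faithful representations are isometric, yet an element `b` of an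
  -- earlier ideal within distance `‖d‖` of `d` gives `‖d‖ = ‖rep (d - b)‖ ≤ ‖d - b‖ < ‖d‖`.
  · rw [C.limit γ hγ h, Metric.mem_closure_iff] at hdγ
    obtain ⟨b, hb, hdb⟩ := hdγ ‖d‖ (norm_pos_iff.2 hd0)
    simp only [Set.mem_iUnion, Set.mem_Iio, exists_prop] at hb
    obtain ⟨β, hβγ, hb⟩ := hb
    have hβ : β < θ := hβγ.trans_le hγ
    have h1 := NonUnitalStarAlgHom.norm_map _ (hinj β hβ hβγ) ⟨d, hd⟩
    have h2 : C.rep β hβ d = C.rep β hβ (d - b) := by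
      rw [map_sub, (C.rep_eq_zero_iff β hβ b).2 hb, sub_zero]
    have h3 := NonUnitalStarAlgHom.norm_apply_le (C.rep β hβ) (d - b)
    rw [← h2] at h3
    have h4 : ‖C.rep β hβ d‖ = ‖d‖ := h1
    rw [dist_eq_norm] at hdb
    linarith

end CompositionSeries

/-! ### Width -/

section Width

open Cardinal

theorem isSeparable_range_of_isCompactOperator {H : Type u} [NormedAddCommGroup H]
    [InnerProductSpace ℂ H] {T : H →L[ℂ] H} (hT : IsCompactOperator T) :
    TopologicalSpace.IsSeparable (Set.range T) := by
  have h1 : Set.range T ⊆ ⋃ n : ℕ, T '' Metric.closedBall 0 n := by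
    rintro _ ⟨x, rfl⟩
    obtain ⟨n, hn⟩ := exists_nat_ge ‖x‖
    exact Set.mem_iUnion.2 ⟨n, x, by simpa using hn, rfl⟩
  refine TopologicalSpace.IsSeparable.mono (.iUnion fun n => ?_) h1
  exact (((hT.isCompact_closure_image_closedBall (f := (T : H →ₗ[ℂ] H)) n).totallyBounded).subset
    subset_closure).isSeparable

theorem countable_support_ellTwo {X : Type u} (f : EllTwo X) : {x | f x ≠ 0}.Countable := by
  have h := (norm_sq_eq_hasSum f).summable.countable_support
  refine h.mono fun x hx => ?_
  simpa using hx

theorem isNondegenerateSubalgebraOfCompacts_compactOps {L : Type v} [NonUnitalRing L] [StarRing L]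
    [Module ℂ L] {ι : Type u} (e : L ≃⋆ₐ[ℂ] compactOps (EllTwo ι)) :
    CantorBendixson.IsNondegenerateSubalgebraOfCompacts L ι := by
  refine ⟨compactOps (EllTwo ι), le_rfl, isClosed_compactOps _, ?_, ⟨e⟩⟩
  rw [eq_top_iff]
  intro f _
  refine mem_closure_of_tendsto (hasSum_stdVec f) (Filter.Eventually.of_forall fun F => ?_)
  refine Submodule.sum_mem _ fun x _ => Submodule.smul_mem _ _ (Submodule.subset_span ?_)
  exact ⟨matrixUnit x x, matrixUnit_mem_compactOps x x, stdVec x,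
    by rw [matrixUnit_apply, stdVec_self, one_smul]⟩

theorem continuous_of_starHom_compactOps {ι ι' : Type u}
    (π : compactOps (EllTwo ι) →⋆ₙₐ[ℂ] (EllTwo ι' →L[ℂ] EllTwo ι')) : Continuous π := by
  have : IsClosed (compactOps (EllTwo ι) : Set (EllTwo ι →L[ℂ] EllTwo ι)) := isClosed_compactOps _
  exact AddMonoidHomClass.continuous_of_bound π 1 fun a => by
    rw [one_mul]; exact NonUnitalStarAlgHom.norm_apply_le π a

/-- The matrix unit at `(s, t)` as an element of the algebra of compact operators. -/
def compactUnit {ι : Type u} (s t : ι) : compactOps (EllTwo ι) :=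
  ⟨matrixUnit s t, matrixUnit_mem_compactOps s t⟩

/-- Since `e_st = e_ss e_st`, the range of each `π(e_st)` lies in that of `π(e_ss)`; linearity and
density of the matrix units do the rest. -/
theorem apply_eq_zero_of_compactUnit {ι ι' : Type u}
    (π : compactOps (EllTwo ι) →⋆ₙₐ[ℂ] (EllTwo ι' →L[ℂ] EllTwo ι')) (ev : EllTwo ι' →L[ℂ] ℂ)
    (h : ∀ s y, ev (π (compactUnit s s) y) = 0) (k : compactOps (EllTwo ι)) (y : EllTwo ι') :
    ev (π k y) = 0 := by
  have hcl : IsClosed {k : compactOps (EllTwo ι) | ev (π k y) = 0} := by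
    refine isClosed_eq (ev.continuous.comp ?_) continuous_const
    exact (ContinuousLinearMap.apply ℂ (EllTwo ι') y).continuous.comp
      (continuous_of_starHom_compactOps π)
  refine closure_minimal ?_ hcl (compactOps_mem_closure_span k)
  intro x hx
  change ev (π x y) = 0
  induction hx using Submodule.span_induction with
  | mem x hx =>
    obtain ⟨s, t, hst⟩ := hx
    have hx : x = compactUnit s s * compactUnit s t :=
      Subtype.ext (hst.trans (matrixUnit_mul_matrixUnit s s t).symm)
    rw [hx, map_mul]
    exact h s _
  | zero => rw [map_zero]; exact map_zero ev
  | add x y _ _ hx hy => rw [map_add, add_apply, map_add, hx, hy, add_zero]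
  | smul a x _ hx =>
    rw [map_smul π a x, smul_apply, map_smul, hx, smul_zero]

/-- Each `π(e_ss)` is compact, so its range is separable and involves only countably many
coordinates. By nondegeneracy these countable sets, one for each `s : ι`, cover `ι'`. -/
theorem mk_le_of_representation {ι ι' : Type u} [Infinite ι]
    (π : compactOps (EllTwo ι) →⋆ₙₐ[ℂ] (EllTwo ι' →L[ℂ] EllTwo ι'))
    (hcomp : ∀ k, IsCompactOperator (π k))
    (hnd : (Submodule.span ℂ {x : EllTwo ι' | ∃ k y, π k y = x}).topologicalClosure = ⊤) :
    #ι' ≤ #ι := by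
  have hsep : ∀ s, ∃ c : Set (EllTwo ι'),
      c.Countable ∧ Set.range (π (compactUnit s s)) ⊆ closure c :=
    fun s => isSeparable_range_of_isCompactOperator (hcomp (compactUnit s s))
  choose c hcc hcs using hsep
  have hWc : ∀ s, (⋃ v ∈ c s, {x | v x ≠ 0}).Countable := fun s =>
    (hcc s).biUnion fun v _ => countable_support_ellTwo v
  have hcover : ∀ i, ∃ s, i ∈ ⋃ v ∈ c s, {x | v x ≠ 0} := by
    intro i
    by_contra hi
    simp only [Set.mem_iUnion, Set.mem_ofPred_eq, not_exists, not_not] at hi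
    have hdiag : ∀ s y, innerSL ℂ (stdVec i) (π (compactUnit s s) y) = 0 := by
      intro s y
      have hcl : IsClosed {x : EllTwo ι' | innerSL ℂ (stdVec i) x = 0} :=
        isClosed_eq (innerSL ℂ (stdVec i)).continuous continuous_const
      exact closure_minimal (fun v hv => (inner_stdVec_left i v).trans (hi s v hv)) hcl
        (hcs s ⟨y, rfl⟩)
    -- An uncovered coordinate `i` would vanish on the whole dense span, but it does not vanish on
    -- `stdVec i`.
    have hker : (Submodule.span ℂ {x : EllTwo ι' | ∃ k y, π k y = x}).topologicalClosure ≤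
        LinearMap.ker (innerSL ℂ (stdVec i) : EllTwo ι' →ₗ[ℂ] ℂ) := by
      refine Submodule.topologicalClosure_minimal _ (Submodule.span_le.2 ?_)
        (isClosed_eq (innerSL ℂ (stdVec i)).continuous continuous_const)
      rintro _ ⟨k, y, rfl⟩
      exact apply_eq_zero_of_compactUnit π _ hdiag k y
    rw [hnd] at hker
    have h1 : innerSL ℂ (stdVec i) (stdVec i) = 0 := hker (Submodule.mem_top (x := stdVec i))
    rw [innerSL_apply_apply, inner_stdVec_left, stdVec_self] at h1
    exact one_ne_zero h1
  have huniv : (Set.univ : Set ι') = ⋃ s, ⋃ v ∈ c s, {x | v x ≠ 0} :=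
    (Set.eq_univ_of_forall fun i => Set.mem_iUnion.2 (hcover i)).symm
  calc #ι' = #(⋃ s, ⋃ v ∈ c s, {x | v x ≠ 0}) := by rw [← huniv, mk_univ]
    _ ≤ Cardinal.sum fun s => #(⋃ v ∈ c s, {x | v x ≠ 0}) := mk_iUnion_le_sum_mk
    _ ≤ Cardinal.sum fun _ : ι => ℵ₀ := Cardinal.sum_le_sum _ _ fun s => (hWc s).le_aleph0
    _ = #ι * ℵ₀ := by simp
    _ = #ι := mul_eq_left (aleph0_le_mk ι) (aleph0_le_mk ι) aleph0_ne_zero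

theorem mk_le_of_isNondegenerateSubalgebraOfCompacts {L : Type v} [NonUnitalRing L] [StarRing L]
    [Module ℂ L] {ι ι' : Type u} [Infinite ι] (e : L ≃⋆ₐ[ℂ] compactOps (EllTwo ι))
    (h : CantorBendixson.IsNondegenerateSubalgebraOfCompacts L ι') : #ι' ≤ #ι := by
  obtain ⟨B, hBK, -, hnd, ⟨e'⟩⟩ := h
  let ψ : compactOps (EllTwo ι) ≃⋆ₐ[ℂ] B := e.symm.trans e'
  refine mk_le_of_representation ((NonUnitalStarSubalgebraClass.subtype B).comp
    (ψ : compactOps (EllTwo ι) →⋆ₙₐ[ℂ] B)) (fun k => hBK (ψ k).2) ?_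
  rw [← hnd]
  congr 2
  ext x
  constructor
  · rintro ⟨k, y, rfl⟩
    exact ⟨_, (ψ k).2, y, rfl⟩
  · rintro ⟨T, hT, y, rfl⟩
    refine ⟨ψ.symm ⟨T, hT⟩, y, ?_⟩
    change (ψ (ψ.symm ⟨T, hT⟩)).1 y = T y
    rw [ψ.apply_symm_apply]

/-- The supremum is attained at the bottom layer, which exists because the height is nonzero. -/
theorem CantorBendixson.isWidth_of_layers {A : Type u} [NonUnitalCStarAlgebra A]
    {S : CantorBendixson A} {κ : Cardinal.{u}} (hκ : ℵ₀ ≤ κ)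
    (h : ∀ α, α < S.height → Nonempty (S.layer α ≃⋆ₐ[ℂ] compactOps (EllTwo κ.out)))
    (h0 : S.height ≠ 0) : S.IsWidth κ := by
  constructor
  · rintro μ ⟨α, hα, hμ⟩
    obtain ⟨e⟩ := h α hα
    have : Infinite κ.out := infinite_iff.2 (by rwa [mk_out])
    have := mk_le_of_isNondegenerateSubalgebraOfCompacts e hμ
    rwa [mk_out, mk_out] at this
  · intro μ hμ
    have h0' : 0 < S.height := pos_iff_ne_zero.2 h0
    obtain ⟨e⟩ := h 0 h0'
    exact hμ ⟨0, h0', isNondegenerateSubalgebraOfCompacts_compactOps e⟩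

end Width

/-! ### The index set -/

section Levels

variable {θ : Ordinal.{u}} {K : Type u} [Zero K]

/-- Finitely supported `K`-valued functions on `θ`, with an extra natural number on top. -/
abbrev LevelIndex (θ : Ordinal.{u}) (K : Type u) [Zero K] : Type u := (θ.ToType →₀ K) × ℕ

/-- The ordinal corresponding to an element of `θ`. -/
def level (i : θ.ToType) : Ordinal.{u} := (i.toOrd : Ordinal)

theorem exists_level_eq {o : Ordinal.{u}} (ho : o < θ) : ∃ i : θ.ToType, level i = o :=
  ⟨Ordinal.ToType.mk ⟨o, ho⟩, by simp [level]⟩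

open Classical in
/-- The element that agrees with `x` below level `o` and with `s` from level `o` on. -/
def glue (o : Ordinal.{u}) (x s : LevelIndex θ K) : LevelIndex θ K :=
  -- The natural number counts as lying above every level, so it always comes from `s`.
  (Finsupp.onFinset (x.1.support ∪ s.1.support) (fun i => if level i < o then x.1 i else s.1 i)
    (fun i => by
      intro h
      rw [Finset.mem_union, Finsupp.mem_support_iff, Finsupp.mem_support_iff]
      split_ifs at h
      · exact Or.inl h
      · exact Or.inr h), s.2)

theorem glue_fst_of_lt {o : Ordinal.{u}} (x s : LevelIndex θ K) {i : θ.ToType} (h : level i < o) :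
    (glue o x s).1 i = x.1 i := by
  simp [glue, h]

theorem glue_fst_of_le {o : Ordinal.{u}} (x s : LevelIndex θ K) {i : θ.ToType} (h : o ≤ level i) :
    (glue o x s).1 i = s.1 i := by
  simp [glue, h]

theorem levelIndex_ext {x y : LevelIndex θ K} (h : ∀ i, x.1 i = y.1 i) (h' : x.2 = y.2) : x = y :=
  Prod.ext (Finsupp.ext h) h'

theorem glue_self (o : Ordinal.{u}) (x : LevelIndex θ K) : glue o x x = x := by
  refine levelIndex_ext (fun i => ?_) rfl
  rcases lt_or_ge (level i) o with h | h
  · rw [glue_fst_of_lt _ _ h]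
  · rw [glue_fst_of_le _ _ h]

/-- This and the next two laws, with `glue_self`, are the only facts about `glue` needed to multiply
matrix units of different levels. -/
theorem glue_glue_left {o o' : Ordinal.{u}} (ho : o ≤ o') (x y z : LevelIndex θ K) :
    glue o (glue o' x y) z = glue o x z := by
  refine levelIndex_ext (fun i => ?_) rfl
  rcases lt_or_ge (level i) o with h | h
  · rw [glue_fst_of_lt _ _ h, glue_fst_of_lt _ _ h, glue_fst_of_lt _ _ (h.trans_le ho)]
  · rw [glue_fst_of_le _ _ h, glue_fst_of_le _ _ h]

theorem glue_glue_right {o o' : Ordinal.{u}} (ho : o ≤ o') (x y z : LevelIndex θ K) :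
    glue o' x (glue o y z) = glue o' x z := by
  refine levelIndex_ext (fun i => ?_) rfl
  rcases lt_or_ge (level i) o' with h | h
  · rw [glue_fst_of_lt _ _ h, glue_fst_of_lt _ _ h]
  · rw [glue_fst_of_le _ _ h, glue_fst_of_le _ _ h, glue_fst_of_le _ _ (ho.trans h)]

theorem glue_assoc {o o' : Ordinal.{u}} (ho : o ≤ o') (x y z : LevelIndex θ K) :
    glue o x (glue o' y z) = glue o' (glue o x y) z := by
  refine levelIndex_ext (fun i => ?_) rfl
  rcases lt_or_ge (level i) o with h | h
  · rw [glue_fst_of_lt _ _ h, glue_fst_of_lt _ _ (h.trans_le ho), glue_fst_of_lt _ _ h]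
  · rw [glue_fst_of_le _ _ h]
    rcases lt_or_ge (level i) o' with hi | hi
    · rw [glue_fst_of_lt _ _ hi, glue_fst_of_lt _ _ hi, glue_fst_of_le _ _ h]
    · rw [glue_fst_of_le _ _ hi, glue_fst_of_le _ _ hi]

/-! ### Matrix units at a given level -/

open Classical in
/-- The partial bijection replacing the part `t` from level `o` on by `s`. -/
def levelPEquiv (o : Ordinal.{u}) (s t : LevelIndex θ K) : LevelIndex θ K ≃. LevelIndex θ K where
  toFun x := if glue o x t = x then some (glue o x s) else none
  invFun x := if glue o x s = x then some (glue o x t) else none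
  inv a b := by
    simp only [Option.ite_none_right_eq_some, Option.some_inj]
    constructor
    · rintro ⟨h1, rfl⟩
      rw [glue_glue_left le_rfl, glue_glue_left le_rfl]
      exact ⟨rfl, h1⟩
    · rintro ⟨h1, rfl⟩
      rw [glue_glue_left le_rfl, glue_glue_left le_rfl]
      exact ⟨rfl, h1⟩

theorem mem_levelPEquiv {o : Ordinal.{u}} {s t x y : LevelIndex θ K} :
    y ∈ levelPEquiv o s t x ↔ glue o x t = x ∧ glue o x s = y := by
  classical
  change y ∈ (if glue o x t = x then some (glue o x s) else none) ↔ _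
  simp

theorem levelPEquiv_of_eq {o : Ordinal.{u}} {s t x : LevelIndex θ K} (h : glue o x t = x) :
    levelPEquiv o s t x = some (glue o x s) :=
  mem_levelPEquiv.2 ⟨h, rfl⟩

theorem levelPEquiv_of_ne {o : Ordinal.{u}} {s t x : LevelIndex θ K} (h : glue o x t ≠ x) :
    levelPEquiv o s t x = none := by
  rw [Option.eq_none_iff_forall_not_mem]
  intro y hy
  exact h (mem_levelPEquiv.1 hy).1

/-- The lower level wins. A point passes both tests when it agrees with `t'` from `o'` on and with
`t` between `o` and `o'`; everything from `o` on is then overwritten by `s`. -/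
theorem levelPEquiv_trans_of_eq {o o' : Ordinal.{u}} (ho : o ≤ o') {s t s' t' : LevelIndex θ K}
    (h : glue o' t s' = t) :
    (levelPEquiv o' s' t').trans (levelPEquiv o s t) = levelPEquiv o s (glue o' t t') := by
  ext x c
  rw [← Option.mem_def, ← Option.mem_def, PEquiv.mem_trans, mem_levelPEquiv]
  simp only [mem_levelPEquiv]
  constructor
  · rintro ⟨b, ⟨h1, rfl⟩, h2, h3⟩
    rw [glue_glue_left ho] at h2 h3
    refine ⟨?_, h3⟩
    rw [glue_assoc ho, h2, glue_glue_left le_rfl, h1]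
  · rintro ⟨h1, h2⟩
    rw [glue_assoc ho] at h1
    refine ⟨_, ⟨?_, rfl⟩, ?_, ?_⟩
    · rw [← h1, glue_glue_left le_rfl]
    · rw [glue_glue_left ho]
      conv_rhs => rw [← h1, glue_glue_left le_rfl, ← glue_assoc ho, h]
    · rwa [glue_glue_left ho]

/-- After the first map a point agrees with `s'` from `o'` on, so it cannot also agree with `t`
there. -/
theorem levelPEquiv_trans_of_ne {o o' : Ordinal.{u}} (ho : o ≤ o') {s t s' t' : LevelIndex θ K}
    (h : glue o' t s' ≠ t) : (levelPEquiv o' s' t').trans (levelPEquiv o s t) = ⊥ := by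
  ext1 x
  rw [PEquiv.bot_apply, Option.eq_none_iff_forall_not_mem]
  intro c hc
  rw [PEquiv.mem_trans] at hc
  simp only [mem_levelPEquiv] at hc
  obtain ⟨b, ⟨h1, rfl⟩, h2, h3⟩ := hc
  rw [glue_glue_left ho] at h2
  apply h
  have h4 : t = glue o' (glue o t x) s' := by
    rw [← glue_assoc ho, ← h2, glue_glue_right le_rfl, glue_self]
  rw [h4, glue_glue_left le_rfl]

/-- The matrix unit at level `o`. -/
def levelUnit (o : Ordinal.{u}) (s t : LevelIndex θ K) :
    EllTwo (LevelIndex θ K) →L[ℂ] EllTwo (LevelIndex θ K) :=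
  partialOp (levelPEquiv o s t)

theorem star_levelUnit (o : Ordinal.{u}) (s t : LevelIndex θ K) :
    star (levelUnit o s t) = levelUnit o t s :=
  star_partialOp _

/-- The matrix units at levels below `b`. -/
def levelUnits (θ : Ordinal.{u}) (K : Type u) [Zero K] (b : Ordinal.{u}) :
    Set (EllTwo (LevelIndex θ K) →L[ℂ] EllTwo (LevelIndex θ K)) :=
  {T | ∃ o s t, o < b ∧ T = levelUnit o s t}

theorem levelUnit_mul_of_le {o o' : Ordinal.{u}} (ho : o ≤ o') (s t s' t' : LevelIndex θ K) :
    levelUnit o s t * levelUnit o' s' t' = 0 ∨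
      levelUnit o s t * levelUnit o' s' t' = levelUnit o s (glue o' t t') := by
  have h1 : levelUnit o s t * levelUnit o' s' t' =
      partialOp ((levelPEquiv o' s' t').trans (levelPEquiv o s t)) := (partialOp_trans _ _).symm
  by_cases h : glue o' t s' = t
  · right; rw [h1, levelPEquiv_trans_of_eq ho h]; rfl
  · left; rw [h1, levelPEquiv_trans_of_ne ho h, partialOp_bot]

/-- Only one of the two levels has to be below `b`, which is what makes the level algebras ideals.
The case `o' ≤ o` is the adjoint of the case `o ≤ o'`. -/
theorem levelUnit_mul_mem {o o' b : Ordinal.{u}} (h : min o o' < b) (s t s' t' : LevelIndex θ K) :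
    levelUnit o s t * levelUnit o' s' t' ∈ Submodule.span ℂ (levelUnits θ K b) := by
  rcases le_total o o' with ho | ho
  · rw [min_eq_left ho] at h
    rcases levelUnit_mul_of_le ho s t s' t' with h1 | h1
    · rw [h1]; exact Submodule.zero_mem _
    · rw [h1]; exact Submodule.subset_span ⟨o, _, _, h, rfl⟩
  · rw [min_eq_right ho] at h
    have h2 : levelUnit o s t * levelUnit o' s' t' =
        star (levelUnit o' t' s' * levelUnit o t s) := by
      rw [star_mul, star_levelUnit, star_levelUnit]
    rcases levelUnit_mul_of_le ho t' s' t s with h1 | h1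
    · rw [h2, h1, star_zero]; exact Submodule.zero_mem _
    · rw [h2, h1, star_levelUnit]; exact Submodule.subset_span ⟨o', _, _, h, rfl⟩

theorem span_mul_mem_span {R : Type u} [NonUnitalRing R] [Module ℂ R] [IsScalarTower ℂ R R]
    [SMulCommClass ℂ R R] {s₁ s₂ s₃ : Set R}
    (h : ∀ x ∈ s₁, ∀ y ∈ s₂, x * y ∈ Submodule.span ℂ s₃) {x y : R}
    (hx : x ∈ Submodule.span ℂ s₁) (hy : y ∈ Submodule.span ℂ s₂) :
    x * y ∈ Submodule.span ℂ s₃ := by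
  induction hx using Submodule.span_induction with
  | mem x hx =>
    induction hy using Submodule.span_induction with
    | mem y hy => exact h x hx y hy
    | zero => rw [mul_zero]; exact Submodule.zero_mem _
    | add y z _ _ hy hz => rw [mul_add]; exact Submodule.add_mem _ hy hz
    | smul c y _ hy => rw [mul_smul_comm]; exact Submodule.smul_mem _ _ hy
  | zero => rw [zero_mul]; exact Submodule.zero_mem _
  | add x z _ _ hx hz => rw [add_mul]; exact Submodule.add_mem _ hx hz
  | smul c x _ hx => rw [smul_mul_assoc]; exact Submodule.smul_mem _ _ hx

theorem star_mem_span_levelUnits {b : Ordinal.{u}}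
    {x : EllTwo (LevelIndex θ K) →L[ℂ] EllTwo (LevelIndex θ K)}
    (hx : x ∈ Submodule.span ℂ (levelUnits θ K b)) :
    star x ∈ Submodule.span ℂ (levelUnits θ K b) := by
  induction hx using Submodule.span_induction with
  | mem x hx =>
    obtain ⟨o, s, t, ho, rfl⟩ := hx
    rw [star_levelUnit]
    exact Submodule.subset_span ⟨o, _, _, ho, rfl⟩
  | zero => rw [star_zero]; exact Submodule.zero_mem _
  | add x z _ _ hx hz => rw [star_add]; exact Submodule.add_mem _ hx hz
  | smul c x _ hx => rw [star_smul]; exact Submodule.smul_mem _ _ hx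

/-- The `*`-algebra spanned by the matrix units at levels below `b`. -/
def levelSpan (θ : Ordinal.{u}) (K : Type u) [Zero K] (b : Ordinal.{u}) :
    NonUnitalStarSubalgebra ℂ (EllTwo (LevelIndex θ K) →L[ℂ] EllTwo (LevelIndex θ K)) where
  carrier := Submodule.span ℂ (levelUnits θ K b)
  add_mem' := Submodule.add_mem _
  zero_mem' := Submodule.zero_mem _
  smul_mem' := fun c _ hx => Submodule.smul_mem _ c hx
  mul_mem' := by
    refine fun {x y} hx hy => span_mul_mem_span ?_ hx hy
    rintro _ ⟨o, s, t, ho, rfl⟩ _ ⟨o', s', t', ho', rfl⟩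
    exact levelUnit_mul_mem (min_lt_of_left_lt ho) _ _ _ _
  star_mem' := star_mem_span_levelUnits

/-- The `C*`-algebra generated by the matrix units at levels below `b`. -/
def levelAlg (θ : Ordinal.{u}) (K : Type u) [Zero K] (b : Ordinal.{u}) :
    NonUnitalStarSubalgebra ℂ (EllTwo (LevelIndex θ K) →L[ℂ] EllTwo (LevelIndex θ K)) :=
  (levelSpan θ K b).topologicalClosure

theorem mem_levelAlg_iff {b : Ordinal.{u}}
    {T : EllTwo (LevelIndex θ K) →L[ℂ] EllTwo (LevelIndex θ K)} :
    T ∈ levelAlg θ K b ↔ T ∈ closure (Submodule.span ℂ (levelUnits θ K b) : Set _) := Iff.rfl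

instance isClosed_levelAlg (b : Ordinal.{u}) :
    IsClosed (levelAlg θ K b : Set (EllTwo (LevelIndex θ K) →L[ℂ] EllTwo (LevelIndex θ K))) :=
  isClosed_closure

theorem levelUnits_mono {b c : Ordinal.{u}} (h : b ≤ c) : levelUnits θ K b ⊆ levelUnits θ K c := by
  rintro _ ⟨o, s, t, ho, rfl⟩
  exact ⟨o, s, t, ho.trans_le h, rfl⟩

theorem levelAlg_mono {b c : Ordinal.{u}} (h : b ≤ c) : levelAlg θ K b ≤ levelAlg θ K c :=
  NonUnitalStarSubalgebra.topologicalClosure_mono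
    (fun _ hx => Submodule.span_mono (levelUnits_mono h) hx)

theorem levelUnit_mem_levelAlg {o b : Ordinal.{u}} (h : o < b) (s t : LevelIndex θ K) :
    levelUnit o s t ∈ levelAlg θ K b :=
  subset_closure (Submodule.subset_span ⟨o, s, t, h, rfl⟩)

theorem mul_mem_levelAlg_left {b c : Ordinal.{u}}
    {x y : EllTwo (LevelIndex θ K) →L[ℂ] EllTwo (LevelIndex θ K)}
    (hx : x ∈ levelAlg θ K c) (hy : y ∈ levelAlg θ K b) : x * y ∈ levelAlg θ K b := by
  refine map_mem_closure₂ continuous_mul hx hy fun a ha d hd => ?_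
  refine span_mul_mem_span ?_ ha hd
  rintro _ ⟨o, s, t, ho, rfl⟩ _ ⟨o', s', t', ho', rfl⟩
  exact levelUnit_mul_mem (min_lt_of_right_lt ho') _ _ _ _

theorem mul_mem_levelAlg_right {b c : Ordinal.{u}}
    {x y : EllTwo (LevelIndex θ K) →L[ℂ] EllTwo (LevelIndex θ K)}
    (hx : x ∈ levelAlg θ K b) (hy : y ∈ levelAlg θ K c) : x * y ∈ levelAlg θ K b := by
  refine map_mem_closure₂ continuous_mul hx hy fun a ha d hd => ?_
  refine span_mul_mem_span ?_ ha hd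
  rintro _ ⟨o, s, t, ho, rfl⟩ _ ⟨o', s', t', ho', rfl⟩
  exact levelUnit_mul_mem (min_lt_of_left_lt ho) _ _ _ _

theorem eq_zero_of_mem_levelAlg_zero {x : EllTwo (LevelIndex θ K) →L[ℂ] EllTwo (LevelIndex θ K)}
    (hx : x ∈ levelAlg θ K 0) : x = 0 := by
  have h : levelUnits θ K 0 = ∅ := by
    refine Set.eq_empty_of_forall_notMem ?_
    rintro _ ⟨o, _, _, ho, _⟩
    exact not_lt_zero ho
  rw [mem_levelAlg_iff, h, Submodule.span_empty, Submodule.bot_coe, closure_singleton] at hx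
  exact hx

/-- A linear combination involves finitely many levels; this gives continuity of the ideals at
limits. -/
theorem exists_lt_mem_span_levelUnits {γ : Ordinal.{u}} (hγ : Order.IsSuccLimit γ)
    {x : EllTwo (LevelIndex θ K) →L[ℂ] EllTwo (LevelIndex θ K)}
    (hx : x ∈ Submodule.span ℂ (levelUnits θ K γ)) :
    ∃ α < γ, x ∈ Submodule.span ℂ (levelUnits θ K α) := by
  induction hx using Submodule.span_induction with
  | mem x hx =>
    obtain ⟨o, s, t, ho, rfl⟩ := hx
    exact ⟨Order.succ o, hγ.succ_lt ho, Submodule.subset_span ⟨o, s, t, Order.lt_succ o, rfl⟩⟩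
  | zero => exact ⟨0, hγ.bot_lt, Submodule.zero_mem _⟩
  | add x y _ _ hx hy =>
    obtain ⟨α, hα, hx⟩ := hx
    obtain ⟨β, hβ, hy⟩ := hy
    exact ⟨max α β, max_lt hα hβ, Submodule.add_mem _
      (Submodule.span_mono (levelUnits_mono (le_max_left α β)) hx)
      (Submodule.span_mono (levelUnits_mono (le_max_right α β)) hy)⟩
  | smul c x _ hx =>
    obtain ⟨α, hα, hx⟩ := hx
    exact ⟨α, hα, Submodule.smul_mem _ c hx⟩

end Levels

/-! ### Splitting the index set at a level -/

section Splitting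

variable {θ : Ordinal.{u}} {K : Type u} [Zero K]

/-- The base point of the index set. -/
def basePoint (θ : Ordinal.{u}) (K : Type u) [Zero K] : LevelIndex θ K := (0, 0)

/-- The elements that are trivial below level `α`. -/
abbrev UpperPart (θ : Ordinal.{u}) (K : Type u) [Zero K] (α : Ordinal.{u}) : Type u :=
  {x : LevelIndex θ K // glue α (basePoint θ K) x = x}

/-- The elements that are trivial from level `α` on. -/
abbrev LowerPart (θ : Ordinal.{u}) (K : Type u) [Zero K] (α : Ordinal.{u}) : Type u :=
  {x : LevelIndex θ K // glue α x (basePoint θ K) = x}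

/-- The index set splits as the product of its upper and lower parts. -/
def splitEquiv (θ : Ordinal.{u}) (K : Type u) [Zero K] (α : Ordinal.{u}) :
    UpperPart θ K α × LowerPart θ K α ≃ LevelIndex θ K where
  toFun p := glue α p.2.1 p.1.1
  invFun x := (⟨glue α (basePoint θ K) x, glue_glue_right le_rfl _ _ _⟩,
    ⟨glue α x (basePoint θ K), glue_glue_left le_rfl _ _ _⟩)
  left_inv p := by
    obtain ⟨⟨y, hy⟩, ⟨z, hz⟩⟩ := p
    refine Prod.ext (Subtype.ext ?_) (Subtype.ext ?_)
    · change glue α (basePoint θ K) (glue α z y) = y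
      rw [glue_glue_right le_rfl, hy]
    · change glue α (glue α z y) (basePoint θ K) = z
      rw [glue_glue_left le_rfl, hz]
  right_inv x := by
    change glue α (glue α x (basePoint θ K)) (glue α (basePoint θ K) x) = x
    rw [glue_glue_left le_rfl, glue_glue_right le_rfl, glue_self]

/-- The splitting of the index set at level `α`, with the upper part indexed by `ι`. -/
def levelSplit {ι : Type u} {α : Ordinal.{u}} (f : ι ≃ UpperPart θ K α) :
    ι × LowerPart θ K α ≃ LevelIndex θ K :=
  (f.prodCongr (Equiv.refl _)).trans (splitEquiv θ K α)

theorem levelSplit_apply {ι : Type u} {α : Ordinal.{u}} (f : ι ≃ UpperPart θ K α) (i : ι)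
    (z : LowerPart θ K α) : levelSplit f (i, z) = glue α z.1 (f i).1 := rfl

variable {ι : Type u} {α : Ordinal.{u}} (f : ι ≃ UpperPart θ K α)

/-- Overwriting from a level `≥ α` changes only the upper coordinate, and in the same way on every
slice: `j` does not depend on `z`. -/
theorem glue_levelSplit {o : Ordinal.{u}} (ho : α ≤ o) (i : ι) (s : LevelIndex θ K) :
    ∃ j, ∀ z : LowerPart θ K α,
      glue o (levelSplit f (i, z)) s = levelSplit f (j, z) := by
  have h1 : glue α (basePoint θ K) (glue o (f i).1 s) = glue o (f i).1 s := by
    rw [glue_assoc ho, (f i).2]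
  refine ⟨f.symm ⟨glue o (f i).1 s, h1⟩, fun z => ?_⟩
  rw [levelSplit_apply, levelSplit_apply, Equiv.apply_symm_apply, glue_assoc ho]

/-- Matrix units at levels from `α` on are amplified along the splitting at `α`. -/
theorem exists_amplify_eq_levelUnit {o : Ordinal.{u}} (ho : α ≤ o) (s t : LevelIndex θ K) :
    ∃ T, amplify (levelSplit f) T = levelUnit o s t := by
  -- The operator to be amplified is read off from the slice over the base point; by
  -- `glue_levelSplit` every other slice gives the same one.
  set z₀ : LowerPart θ K α := ⟨basePoint θ K, glue_self _ _⟩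
  set σ := ((slice (levelSplit f) z₀).trans (levelPEquiv o s t)).trans
    (slice (levelSplit f) z₀).symm with hσ
  refine ⟨partialOp σ, clm_ext_stdVec fun x => ?_⟩
  obtain ⟨⟨i, z⟩, rfl⟩ := (levelSplit f).surjective x
  rw [amplify_apply, amplifyOp_stdVec, levelUnit]
  obtain ⟨j, hj⟩ := glue_levelSplit f ho i t
  obtain ⟨k, hk⟩ := glue_levelSplit f ho i s
  by_cases hij : j = i
  · have hσi : σ i = some k := by
      rw [hσ, PEquiv.trans_eq_some]
      refine ⟨levelSplit f (k, z₀), ?_, slice_symm_apply _ _ _⟩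
      rw [PEquiv.trans_eq_some]
      refine ⟨_, slice_apply _ _ _, ?_⟩
      rw [levelPEquiv_of_eq (by rw [hj, hij]), hk]
    rw [partialOp_stdVec _ hσi, partialOp_stdVec _ (slice_apply _ _ _),
      partialOp_stdVec _ (levelPEquiv_of_eq (by rw [hj, hij])), hk]
  · have hne : ∀ z, glue o (levelSplit f (i, z)) t ≠ levelSplit f (i, z) := by
      intro z h
      rw [hj, (levelSplit f).apply_eq_iff_eq, Prod.mk.injEq] at h
      exact hij h.1
    have hσi : σ i = none := by
      rw [Option.eq_none_iff_forall_not_mem]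
      intro c hc
      rw [hσ, PEquiv.mem_trans] at hc
      obtain ⟨b, hb, -⟩ := hc
      rw [PEquiv.mem_trans] at hb
      obtain ⟨d, hd, hb⟩ := hb
      rw [slice_apply, Option.mem_some_iff] at hd
      rw [← hd, mem_levelPEquiv] at hb
      exact hne z₀ hb.1
    rw [partialOp_stdVec_of_eq_none _ hσi, map_zero,
      partialOp_stdVec_of_eq_none _ (levelPEquiv_of_ne (hne z))]

theorem amplify_matrixUnit (i j : ι) :
    amplify (levelSplit f) (matrixUnit i j) = levelUnit α (f i).1 (f j).1 := by
  refine clm_ext_stdVec fun x => ?_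
  obtain ⟨⟨k, z⟩, rfl⟩ := (levelSplit f).surjective x
  rw [amplify_apply, amplifyOp_stdVec, levelUnit, matrixUnit_apply]
  have hglue : ∀ l, glue α (levelSplit f (k, z)) (f l).1 = levelSplit f (l, z) := fun l => by
    rw [levelSplit_apply, levelSplit_apply, glue_glue_left le_rfl]
  by_cases hkj : k = j
  · subst hkj
    rw [stdVec_self, one_smul, partialOp_stdVec _ (slice_apply _ _ _),
      partialOp_stdVec _ (levelPEquiv_of_eq (hglue k)), hglue]
  · classical
    rw [stdVec_apply, if_neg (Ne.symm hkj), zero_smul, map_zero,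
      partialOp_stdVec_of_eq_none _ (levelPEquiv_of_ne _)]
    rw [hglue, Ne, (levelSplit f).apply_eq_iff_eq, Prod.mk.injEq]
    exact fun h => hkj h.1.symm

/-- Only the parts of `s` and `t` from level `α` on matter, so both may be normalised to lie in the
upper part. -/
theorem levelUnit_glue (α : Ordinal.{u}) (x y s t : LevelIndex θ K) :
    levelUnit α (glue α x s) (glue α y t) = levelUnit α s t := by
  rw [levelUnit, levelUnit]
  congr 1
  ext x c
  rw [← Option.mem_def, ← Option.mem_def, mem_levelPEquiv, mem_levelPEquiv,
    glue_glue_right le_rfl, glue_glue_right le_rfl]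

theorem exists_amplify_matrixUnit_eq_levelUnit (s t : LevelIndex θ K) :
    ∃ i j, amplify (levelSplit f) (matrixUnit i j) = levelUnit α s t := by
  refine ⟨f.symm ⟨glue α (basePoint θ K) s, glue_glue_right le_rfl _ _ _⟩,
    f.symm ⟨glue α (basePoint θ K) t, glue_glue_right le_rfl _ _ _⟩, ?_⟩
  rw [amplify_matrixUnit, Equiv.apply_symm_apply, Equiv.apply_symm_apply, levelUnit_glue]

theorem amplify_mem_levelAlg {k : EllTwo ι →L[ℂ] EllTwo ι} (hk : IsCompactOperator k) :
    amplify (levelSplit f) k ∈ levelAlg θ K (Order.succ α) := by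
  refine map_mem_closure (continuous_amplify _) (mem_closure_span_matrixUnit hk) ?_
  intro x hx
  change amplify (levelSplit f) x ∈ levelSpan θ K (Order.succ α)
  induction hx using Submodule.span_induction with
  | mem x hx =>
    obtain ⟨s, t, rfl⟩ := hx
    rw [amplify_matrixUnit]
    exact Submodule.subset_span ⟨α, _, _, Order.lt_succ α, rfl⟩
  | zero => rw [map_zero]; exact Submodule.zero_mem _
  | add x y _ _ hx hy => rw [map_add]; exact Submodule.add_mem _ hx hy
  | smul c x _ hx => rw [map_smul]; exact Submodule.smul_mem _ c hx

/-! ### Levels below `α` are negligible along the lower part -/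

/-- A unit at level `o < α` kills every basis vector whose coordinate at `o` differs from that of
`t`, and on a slice this coordinate is that of `z`. A combination of units forbids finitely many
values at finitely many coordinates. -/
theorem exists_finset_comp_slice_eq_zero (hα : α ≤ θ)
    {x : EllTwo (LevelIndex θ K) →L[ℂ] EllTwo (LevelIndex θ K)}
    (hx : x ∈ Submodule.span ℂ (levelUnits θ K α)) :
    ∃ (F : Finset θ.ToType) (V : Finset K), (∀ i ∈ F, level i < α) ∧
      ∀ z : LowerPart θ K α, (∀ i ∈ F, z.1.1 i ∉ V) →
        x ∘L partialOp (slice (levelSplit f) z) = 0 := by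
  classical
  induction hx using Submodule.span_induction with
  | mem x hx =>
    obtain ⟨o, s, t, ho, rfl⟩ := hx
    obtain ⟨i, hi⟩ := exists_level_eq (ho.trans_le hα)
    refine ⟨{i}, {t.1 i}, by simp [hi, ho], fun z hz => clm_ext_stdVec fun k => ?_⟩
    rw [ContinuousLinearMap.comp_apply, partialOp_stdVec _ (slice_apply _ _ _), levelUnit,
      partialOp_stdVec_of_eq_none _ (levelPEquiv_of_ne _)]
    · rfl
    · intro h
      have h1 := congrArg (fun y : LevelIndex θ K => y.1 i) h
      rw [glue_fst_of_le _ _ hi.ge, levelSplit_apply, glue_fst_of_lt _ _ (hi ▸ ho)] at h1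
      exact hz i (Finset.mem_singleton_self i) (by rw [← h1]; exact Finset.mem_singleton_self _)
  | zero => exact ⟨∅, ∅, by simp, fun z _ => by simp⟩
  | add x y _ _ hx hy =>
    obtain ⟨F, V, hF, h⟩ := hx
    obtain ⟨F', V', hF', h'⟩ := hy
    refine ⟨F ∪ F', V ∪ V', ?_, fun z hz => ?_⟩
    · intro i hi
      exact (Finset.mem_union.1 hi).elim (hF i) (hF' i)
    · rw [ContinuousLinearMap.add_comp, h z, h' z, add_zero]
      · exact fun i hi hv => hz i (Finset.mem_union_right _ hi) (Finset.mem_union_right _ hv)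
      · exact fun i hi hv => hz i (Finset.mem_union_left _ hi) (Finset.mem_union_left _ hv)
  | smul c x _ hx =>
    obtain ⟨F, V, hF, h⟩ := hx
    exact ⟨F, V, hF, fun z hz => by rw [ContinuousLinearMap.smul_comp, h z hz, smul_zero]⟩

/-- As `K` is infinite, one value outside `V` can be placed at all coordinates in `F`. -/
theorem exists_lowerPart_notMem [Infinite K] {F : Finset θ.ToType} (V : Finset K)
    (hF : ∀ i ∈ F, level i < α) : ∃ z : LowerPart θ K α, ∀ i ∈ F, z.1.1 i ∉ V := by
  classical
  obtain ⟨c, hc⟩ := Infinite.exists_notMem_finset V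
  set g : θ.ToType →₀ K := Finsupp.onFinset F (fun i => if i ∈ F then c else 0)
    (fun i h => by by_contra hi; simp [hi] at h) with hg
  refine ⟨⟨glue α (g, 0) (basePoint θ K), glue_glue_left le_rfl _ _ _⟩, fun i hi => ?_⟩
  change (glue α (g, 0) (basePoint θ K)).1 i ∉ V
  rw [glue_fst_of_lt _ _ (hF i hi)]
  simpa [hg, hi] using hc

theorem exists_norm_comp_slice_lt [Infinite K] (hα : α ≤ θ)
    {x : EllTwo (LevelIndex θ K) →L[ℂ] EllTwo (LevelIndex θ K)}
    (hx : x ∈ levelAlg θ K α) {ε : ℝ} (hε : 0 < ε) :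
    ∃ z : LowerPart θ K α, ‖x ∘L partialOp (slice (levelSplit f) z)‖ < ε := by
  obtain ⟨y, hy, hxy⟩ := Metric.mem_closure_iff.1 (mem_levelAlg_iff.1 hx) ε hε
  obtain ⟨F, V, hF, h⟩ := exists_finset_comp_slice_eq_zero f hα hy
  obtain ⟨z, hz⟩ := exists_lowerPart_notMem V hF
  refine ⟨z, ?_⟩
  have h1 : x ∘L partialOp (slice (levelSplit f) z) =
      (x - y) ∘L partialOp (slice (levelSplit f) z) := by
    rw [ContinuousLinearMap.sub_comp, h z hz, sub_zero]
  rw [h1]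
  rw [dist_eq_norm] at hxy
  calc ‖(x - y) ∘L partialOp (slice (levelSplit f) z)‖
      ≤ ‖x - y‖ * ‖partialOp (slice (levelSplit f) z)‖ := ContinuousLinearMap.opNorm_comp_le _ _
    _ ≤ ‖x - y‖ * 1 := by gcongr; exact norm_partialOp_le _
    _ < ε := by rwa [mul_one]

/-! ### The representation at a level -/

/-- `T` represents `a` modulo the levels below `α`. -/
def Represents (a : EllTwo (LevelIndex θ K) →L[ℂ] EllTwo (LevelIndex θ K))
    (T : EllTwo ι →L[ℂ] EllTwo ι) : Prop :=
  a - amplify (levelSplit f) T ∈ levelAlg θ K α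

variable {f}

theorem Represents.add {a b : EllTwo (LevelIndex θ K) →L[ℂ] EllTwo (LevelIndex θ K)}
    {S T : EllTwo ι →L[ℂ] EllTwo ι} (ha : Represents f a S) (hb : Represents f b T) :
    Represents f (a + b) (S + T) := by
  rw [Represents, map_add, add_sub_add_comm]
  exact add_mem ha hb

theorem Represents.smul {a : EllTwo (LevelIndex θ K) →L[ℂ] EllTwo (LevelIndex θ K)}
    {T : EllTwo ι →L[ℂ] EllTwo ι} (c : ℂ) (ha : Represents f a T) :
    Represents f (c • a) (c • T) := by
  rw [Represents, map_smul, ← smul_sub]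
  exact SMulMemClass.smul_mem c ha

theorem Represents.sub {a b : EllTwo (LevelIndex θ K) →L[ℂ] EllTwo (LevelIndex θ K)}
    {S T : EllTwo ι →L[ℂ] EllTwo ι} (ha : Represents f a S) (hb : Represents f b T) :
    Represents f (a - b) (S - T) := by
  rw [Represents, map_sub, sub_sub_sub_comm]
  exact sub_mem ha hb

theorem Represents.star {a : EllTwo (LevelIndex θ K) →L[ℂ] EllTwo (LevelIndex θ K)}
    {T : EllTwo ι →L[ℂ] EllTwo ι} (ha : Represents f a T) :
    Represents f (star a) (star T) := by
  rw [Represents, map_star, ← star_sub]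
  exact star_mem ha

theorem represents_zero_iff {a : EllTwo (LevelIndex θ K) →L[ℂ] EllTwo (LevelIndex θ K)} :
    Represents f a 0 ↔ a ∈ levelAlg θ K α := by
  rw [Represents, map_zero, sub_zero]

theorem represents_amplify (T : EllTwo ι →L[ℂ] EllTwo ι) :
    Represents f (amplify (levelSplit f) T) T := by
  rw [Represents, sub_self]
  exact zero_mem _

theorem Represents.mul {a b : EllTwo (LevelIndex θ K) →L[ℂ] EllTwo (LevelIndex θ K)}
    {S T : EllTwo ι →L[ℂ] EllTwo ι} {c : Ordinal.{u}} (ha' : a ∈ levelAlg θ K c)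
    (hb' : b ∈ levelAlg θ K c) (ha : Represents f a S) (hb : Represents f b T) :
    Represents f (a * b) (S * T) := by
  rw [Represents, map_mul]
  -- The errors are multiplied only by `a`, by `b` and by each other, so the ideal property of the
  -- level algebras applies to each term.
  have h : a * b - amplify (levelSplit f) S * amplify (levelSplit f) T =
      a * (b - amplify (levelSplit f) T) + (a - amplify (levelSplit f) S) * b -
        (a - amplify (levelSplit f) S) * (b - amplify (levelSplit f) T) := by
    noncomm_ring
  rw [h]
  exact sub_mem (add_mem (mul_mem_levelAlg_left ha' hb) (mul_mem_levelAlg_right ha hb'))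
    (mul_mem ha hb)

/-- On a slice where `a - T ⊗ 1` has norm below `ε`, `a` acts as `T` up to `ε`, and the slice
embedding is isometric. Uniqueness and completeness arguments for the representing operator rest on
this bound. -/
theorem Represents.norm_le [Infinite K] (hα : α ≤ θ)
    {a : EllTwo (LevelIndex θ K) →L[ℂ] EllTwo (LevelIndex θ K)}
    {T : EllTwo ι →L[ℂ] EllTwo ι} (ha : Represents f a T) : ‖T‖ ≤ ‖a‖ := by
  refine le_of_forall_pos_le_add fun ε hε => ?_
  obtain ⟨z, hz⟩ := exists_norm_comp_slice_lt f hα ha hε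
  refine ContinuousLinearMap.opNorm_le_bound _ (by positivity) fun v => ?_
  set V := partialOp (slice (levelSplit f) z) with hV
  have hVv : ‖V v‖ = ‖v‖ := norm_partialOp_slice_apply _ _ _
  have h1 : V (T v) = a (V v) - ((a - amplify (levelSplit f) T) ∘L V) v := by
    have h2 := congrArg (fun R : EllTwo ι →L[ℂ] EllTwo (LevelIndex θ K) => R v)
      (amplifyOp_comp_slice (levelSplit f) T z)
    have h3 : amplify (levelSplit f) T (V v) = V (T v) := h2
    change _ = a (V v) - (a (V v) - amplify (levelSplit f) T (V v))
    rw [h3]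
    abel
  calc ‖T v‖ = ‖V (T v)‖ := (norm_partialOp_slice_apply _ _ _).symm
    _ ≤ ‖a (V v)‖ + ‖((a - amplify (levelSplit f) T) ∘L V) v‖ := by
        rw [h1]; exact norm_sub_le _ _
    _ ≤ ‖a‖ * ‖V v‖ + ε * ‖v‖ :=
        add_le_add (a.le_opNorm _) (ContinuousLinearMap.le_of_opNorm_le _ hz.le v)
    _ = (‖a‖ + ε) * ‖v‖ := by rw [hVv, add_mul]

theorem Represents.unique [Infinite K] (hα : α ≤ θ)
    {a : EllTwo (LevelIndex θ K) →L[ℂ] EllTwo (LevelIndex θ K)}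
    {S T : EllTwo ι →L[ℂ] EllTwo ι} (hS : Represents f a S) (hT : Represents f a T) : S = T := by
  have h := (hS.sub hT).norm_le hα
  rw [sub_self, norm_zero] at h
  exact sub_eq_zero.1 (norm_le_zero_iff.1 h)

/-- Elements of a closed span of represented elements are represented. -/
theorem exists_represents_of_mem_levelAlg [Infinite K] (hα : α ≤ θ) {b : Ordinal.{u}}
    (C : Submodule ℂ (EllTwo ι →L[ℂ] EllTwo ι))
    (hC : IsClosed (C : Set (EllTwo ι →L[ℂ] EllTwo ι)))
    (h : ∀ x ∈ levelUnits θ K b, ∃ T ∈ C, Represents f x T)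
    {a : EllTwo (LevelIndex θ K) →L[ℂ] EllTwo (LevelIndex θ K)} (ha : a ∈ levelAlg θ K b) :
    ∃ T ∈ C, Represents f a T := by
  have hspan : ∀ x ∈ Submodule.span ℂ (levelUnits θ K b), ∃ T ∈ C, Represents f x T := by
    intro x hx
    induction hx using Submodule.span_induction with
    | mem x hx => exact h x hx
    | zero => exact ⟨0, C.zero_mem, represents_zero_iff.2 (zero_mem _)⟩
    | add x y _ _ hx hy =>
      obtain ⟨S, hS, hx⟩ := hx
      obtain ⟨T, hT, hy⟩ := hy
      exact ⟨S + T, C.add_mem hS hT, hx.add hy⟩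
    | smul c x _ hx =>
      obtain ⟨S, hS, hx⟩ := hx
      exact ⟨c • S, C.smul_mem c hS, hx.smul c⟩
  obtain ⟨x, hx, hxa⟩ := mem_closure_iff_seq_limit.1 (mem_levelAlg_iff.1 ha)
  choose T hTC hT using fun n => hspan (x n) (hx n)
  -- The approximants `x n` converge, and `‖T n - T m‖ ≤ ‖x n - x m‖` by `Represents.norm_le`.
  have hcau : CauchySeq T := by
    rw [Metric.cauchySeq_iff']
    intro ε hε
    obtain ⟨N, hN⟩ := Metric.cauchySeq_iff'.1 hxa.cauchySeq ε hε
    refine ⟨N, fun n hn => lt_of_le_of_lt ?_ (hN n hn)⟩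
    rw [dist_eq_norm, dist_eq_norm]
    exact ((hT n).sub (hT N)).norm_le hα
  obtain ⟨S, hS⟩ := cauchySeq_tendsto_of_complete hcau
  refine ⟨S, hC.mem_of_tendsto hS (Filter.Eventually.of_forall hTC), ?_⟩
  have hlim : Filter.Tendsto (fun n => x n - amplify (levelSplit f) (T n)) Filter.atTop
      (nhds (a - amplify (levelSplit f) S)) :=
    hxa.sub (((continuous_amplify (levelSplit f)).tendsto S).comp hS)
  exact (isClosed_levelAlg α).mem_of_tendsto hlim (Filter.Eventually.of_forall hT)

/-- Units below `α` are represented by `0`, and units from `α` on are amplifications. -/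
theorem exists_represents [Infinite K] (hα : α ≤ θ) (f : ι ≃ UpperPart θ K α)
    (a : levelAlg θ K θ) : ∃ T, Represents f a.1 T := by
  obtain ⟨T, -, hT⟩ := exists_represents_of_mem_levelAlg (f := f) hα ⊤ isClosed_univ (b := θ)
    (fun x hx => by
      obtain ⟨o, s, t, ho, rfl⟩ := hx
      rcases lt_or_ge o α with h | h
      · exact ⟨0, Submodule.mem_top, represents_zero_iff.2 (levelUnit_mem_levelAlg h s t)⟩
      · obtain ⟨T, hT⟩ := exists_amplify_eq_levelUnit f h s t
        exact ⟨T, Submodule.mem_top, hT ▸ represents_amplify T⟩) a.2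
  exact ⟨T, hT⟩

/-- Below `α + 1` the only units not represented by `0` are those at level `α`, which amplify matrix
units; the compact operators form a closed subspace. -/
theorem exists_represents_compact [Infinite K] (hα : α ≤ θ) (f : ι ≃ UpperPart θ K α)
    {a : EllTwo (LevelIndex θ K) →L[ℂ] EllTwo (LevelIndex θ K)}
    (ha : a ∈ levelAlg θ K (Order.succ α)) : ∃ T : EllTwo ι →L[ℂ] EllTwo ι, IsCompactOperator T ∧ Represents f a T := by
  refine exists_represents_of_mem_levelAlg (f := f) hα
    (compactOps (EllTwo ι)).toNonUnitalSubalgebra.toSubmodule (isClosed_compactOps _) ?_ ha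
  rintro _ ⟨o, s, t, ho, rfl⟩
  rcases (Order.lt_succ_iff.1 ho).lt_or_eq with h | h
  · exact ⟨0, Submodule.zero_mem _, represents_zero_iff.2 (levelUnit_mem_levelAlg h s t)⟩
  · subst h
    obtain ⟨i, j, hT⟩ := exists_amplify_matrixUnit_eq_levelUnit f s t
    exact ⟨matrixUnit i j, matrixUnit_mem_compactOps i j, hT ▸ represents_amplify _⟩

/-- The representation of the level algebra on `ℓ₂` of the upper part. -/
def levelRep [Infinite K] (hα : α ≤ θ) (f : ι ≃ UpperPart θ K α) :
    levelAlg θ K θ →⋆ₙₐ[ℂ] (EllTwo ι →L[ℂ] EllTwo ι) where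
  toFun a := (exists_represents hα f a).choose
  -- Both sides of each identity represent the same element modulo the levels below `α`, so
  -- uniqueness applies.
  map_smul' c a := ((exists_represents hα f _).choose_spec).unique hα
    ((exists_represents hα f a).choose_spec.smul c)
  map_zero' := ((exists_represents hα f 0).choose_spec).unique hα
    (represents_zero_iff.2 (zero_mem _))
  map_add' a b := ((exists_represents hα f (a + b)).choose_spec).unique hα
    ((exists_represents hα f a).choose_spec.add (exists_represents hα f b).choose_spec)
  map_mul' a b := ((exists_represents hα f (a * b)).choose_spec).unique hα
    ((exists_represents hα f a).choose_spec.mul a.2 b.2 (exists_represents hα f b).choose_spec)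
  map_star' a := ((exists_represents hα f (star a)).choose_spec).unique hα
    (exists_represents hα f a).choose_spec.star

theorem represents_levelRep [Infinite K] (hα : α ≤ θ) (f : ι ≃ UpperPart θ K α)
    (a : levelAlg θ K θ) : Represents f a.1 (levelRep hα f a) :=
  (exists_represents hα f a).choose_spec

theorem levelRep_eq_zero_iff [Infinite K] (hα : α ≤ θ) (f : ι ≃ UpperPart θ K α)
    (a : levelAlg θ K θ) : levelRep hα f a = 0 ↔ a.1 ∈ levelAlg θ K α := by
  rw [← represents_zero_iff (f := f)]
  refine ⟨fun h => ?_, fun h => (represents_levelRep hα f a).unique hα h⟩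
  rw [← h]
  exact represents_levelRep hα f a

theorem isCompactOperator_levelRep_iff [Infinite K] (hα : α ≤ θ) (f : ι ≃ UpperPart θ K α)
    (a : levelAlg θ K θ) :
    IsCompactOperator (levelRep hα f a) ↔ a.1 ∈ levelAlg θ K (Order.succ α) := by
  constructor
  · intro h
    have h1 := levelAlg_mono (Order.le_succ α) (represents_levelRep hα f a)
    simpa using add_mem h1 (amplify_mem_levelAlg f h)
  · intro h
    obtain ⟨T, hT, hrep⟩ := exists_represents_compact hα f h
    rwa [(represents_levelRep hα f a).unique hα hrep]

/-- The copy of the compact operators at level `α`. -/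
def levelSec (hα : α < θ) (f : ι ≃ UpperPart θ K α) :
    compactOps (EllTwo ι) →⋆ₙₐ[ℂ] levelAlg θ K θ where
  toFun k := ⟨amplify (levelSplit f) k.1,
    levelAlg_mono (Order.succ_le_of_lt hα) (amplify_mem_levelAlg f k.2)⟩
  map_smul' c k := Subtype.ext (map_smul (amplify (levelSplit f)) c k.1)
  map_zero' := Subtype.ext (map_zero (amplify (levelSplit f)))
  map_add' k l := Subtype.ext (map_add (amplify (levelSplit f)) k.1 l.1)
  map_mul' k l := Subtype.ext (map_mul (amplify (levelSplit f)) k.1 l.1)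
  map_star' k := Subtype.ext (map_star (amplify (levelSplit f)) k.1)

/-- The ideal of the level algebra generated by the levels below `b`. -/
def levelIdeal (θ : Ordinal.{u}) (K : Type u) [Zero K] (b : Ordinal.{u}) :
    ClosedIdeal (levelAlg θ K θ) where
  toNonUnitalStarSubalgebra :=
    (levelAlg θ K b).comap (NonUnitalStarSubalgebraClass.subtype (levelAlg θ K θ))
  isClosed := (isClosed_levelAlg b).preimage continuous_subtype_val
  mul_mem_left a _ hx := mul_mem_levelAlg_left a.2 hx
  mul_mem_right a _ hx := mul_mem_levelAlg_right hx a.2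

theorem mem_levelIdeal {b : Ordinal.{u}} {a : levelAlg θ K θ} :
    a ∈ (levelIdeal θ K b).carrier ↔ a.1 ∈ levelAlg θ K b := Iff.rfl

theorem levelIdeal_limit {γ : Ordinal.{u}} (hγθ : γ ≤ θ) (hγ : Order.IsSuccLimit γ) :
    (levelIdeal θ K γ).carrier = closure (⋃ α ∈ Set.Iio γ, (levelIdeal θ K α).carrier) := by
  refine Set.Subset.antisymm ?_ ?_
  · intro a ha
    rw [Topology.IsInducing.subtypeVal.closure_eq_preimage_closure_image, Set.mem_preimage]
    refine closure_mono ?_ (mem_levelIdeal.1 ha)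
    intro x hx
    obtain ⟨α, hα, hxα⟩ := exists_lt_mem_span_levelUnits hγ hx
    have hxα' : x ∈ levelAlg θ K α := subset_closure hxα
    exact ⟨⟨x, levelAlg_mono (hα.le.trans hγθ) hxα'⟩, Set.mem_biUnion hα hxα', rfl⟩
  · refine closure_minimal ?_ (levelIdeal θ K γ).isClosed
    refine Set.iUnion₂_subset fun α hα a ha => ?_
    exact levelAlg_mono (le_of_lt hα) ha

/-- The composition series of the level algebra. -/
def levelSeries [Infinite K] (f : ∀ α, α < θ → ι ≃ UpperPart θ K α) :
    CompositionSeries (levelAlg θ K θ) θ ι where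
  ideal := levelIdeal θ K
  ideal_zero := by
    ext a
    rw [mem_levelIdeal, Set.mem_singleton_iff]
    refine ⟨fun h => Subtype.ext (eq_zero_of_mem_levelAlg_zero h), ?_⟩
    rintro rfl
    exact zero_mem _
  mono _ _ h _ _ ha := levelAlg_mono h ha
  limit _ := levelIdeal_limit
  ideal_top := Set.eq_univ_of_forall fun a => a.2
  rep α hα := levelRep hα.le (f α hα)
  rep_eq_zero_iff α hα a := levelRep_eq_zero_iff hα.le (f α hα) a
  isCompactOperator_rep_iff α hα a := isCompactOperator_levelRep_iff hα.le (f α hα) a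
  sec α hα := levelSec hα (f α hα)
  continuous_sec α hα :=
    ((continuous_amplify _).comp continuous_subtype_val).subtype_mk _
  rep_sec α hα k := (represents_levelRep hα.le (f α hα) _).unique hα.le (represents_amplify k.1)

end Splitting

open scoped TensorProduct

/-! ### Stability -/

section Stability

variable {θ : Ordinal.{u}} {K : Type u} [Zero K]

/-- Absorbing an extra natural number into the index set. -/
def absorb (θ : Ordinal.{u}) (K : Type u) [Zero K] : LevelIndex θ K × ℕ ≃ LevelIndex θ K :=
  (Equiv.prodAssoc _ _ _).trans ((Equiv.refl _).prodCongr Nat.pairEquiv)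

/-- The identification `absorb` with the factors exchanged. -/
def absorbSwap (θ : Ordinal.{u}) (K : Type u) [Zero K] : ℕ × LevelIndex θ K ≃ LevelIndex θ K :=
  (Equiv.prodComm _ _).trans (absorb θ K)

theorem absorbSwap_apply (n : ℕ) (x : LevelIndex θ K) :
    absorbSwap θ K (n, x) = absorb θ K (x, n) := rfl

theorem glue_absorb (o : Ordinal.{u}) (x t : LevelIndex θ K) (m n : ℕ) :
    glue o (absorb θ K (x, m)) (absorb θ K (t, n)) = absorb θ K (glue o x t, n) :=
  rfl

/-- The product `(a ⊗ 1)(1 ⊗ b)` has the matrix of `a ⊗ b`. The opposite order has the same matrix,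
hence the two amplifications commute. -/
theorem amplify_absorb_mul_apply (a : EllTwo (LevelIndex θ K) →L[ℂ] EllTwo (LevelIndex θ K))
    (b : EllTwo ℕ →L[ℂ] EllTwo ℕ) (x y : LevelIndex θ K) (m n : ℕ) :
    (amplify (absorb θ K) a * amplify (absorbSwap θ K) b) (stdVec (absorb θ K (x, m)))
      (absorb θ K (y, n)) = a (stdVec x) y * b (stdVec m) n := by
  change amplifyOp (absorb θ K) a (amplifyOp (absorbSwap θ K) b
    (stdVec (absorbSwap θ K (m, x)))) (absorb θ K (y, n)) = _
  rw [amplifyOp_apply, amplifyOp_stdVec]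
  have h : partialOp (slice (absorb θ K) n).symm (partialOp (slice (absorbSwap θ K) x)
      (b (stdVec m))) = b (stdVec m) n • stdVec x := by
    classical
    refine ellTwo_ext fun y => ?_
    rw [partialOp_slice_symm_apply, ← absorbSwap_apply, ellTwo_smul_apply, stdVec_apply]
    by_cases hy : y = x
    · subst hy
      rw [partialOp_slice_apply_self]; simp
    · rw [partialOp_slice_apply_of_ne _ hy]; simp [hy]
  rw [h, map_smul, ellTwo_smul_apply, mul_comm]

theorem amplify_absorbSwap_mul_apply (a : EllTwo (LevelIndex θ K) →L[ℂ] EllTwo (LevelIndex θ K))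
    (b : EllTwo ℕ →L[ℂ] EllTwo ℕ) (x y : LevelIndex θ K) (m n : ℕ) :
    (amplify (absorbSwap θ K) b * amplify (absorb θ K) a) (stdVec (absorb θ K (x, m)))
      (absorb θ K (y, n)) = a (stdVec x) y * b (stdVec m) n := by
  change amplifyOp (absorbSwap θ K) b (amplifyOp (absorb θ K) a
    (stdVec (absorb θ K (x, m)))) (absorbSwap θ K (n, y)) = _
  rw [amplifyOp_apply, amplifyOp_stdVec]
  have h : partialOp (slice (absorbSwap θ K) y).symm (partialOp (slice (absorb θ K) m)
      (a (stdVec x))) = a (stdVec x) y • stdVec m := by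
    classical
    refine ellTwo_ext fun k => ?_
    rw [partialOp_slice_symm_apply, absorbSwap_apply, ellTwo_smul_apply, stdVec_apply]
    by_cases hy : k = m
    · subst hy
      rw [partialOp_slice_apply_self]; simp
    · rw [partialOp_slice_apply_of_ne _ hy]; simp [hy]
  rw [h, map_smul, ellTwo_smul_apply]

theorem amplify_absorb_comm (a : EllTwo (LevelIndex θ K) →L[ℂ] EllTwo (LevelIndex θ K))
    (b : EllTwo ℕ →L[ℂ] EllTwo ℕ) :
    amplify (absorb θ K) a * amplify (absorbSwap θ K) b =
      amplify (absorbSwap θ K) b * amplify (absorb θ K) a := by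
  refine clm_ext_matrix fun x y => ?_
  obtain ⟨⟨x, m⟩, rfl⟩ := (absorb θ K).surjective x
  obtain ⟨⟨y, n⟩, rfl⟩ := (absorb θ K).surjective y
  rw [amplify_absorb_mul_apply, amplify_absorbSwap_mul_apply]

/-- The crux of stability: the natural number lies above every level, so a further matrix unit on
`ℕ` only refines the part prescribed by a unit and leaves its level unchanged. -/
theorem amplify_levelUnit_mul_matrixUnit (o : Ordinal.{u}) (s t : LevelIndex θ K) (k l : ℕ) :
    amplify (absorb θ K) (levelUnit o s t) * amplify (absorbSwap θ K) (matrixUnit k l) =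
      levelUnit o (absorb θ K (s, k)) (absorb θ K (t, l)) := by
  classical
  refine clm_ext_matrix fun x y => ?_
  obtain ⟨⟨x, m⟩, rfl⟩ := (absorb θ K).surjective x
  obtain ⟨⟨y, n⟩, rfl⟩ := (absorb θ K).surjective y
  rw [amplify_absorb_mul_apply, levelUnit, levelUnit, matrixUnit, partialOp_stdVec_apply,
    partialOp_stdVec_apply, partialOp_stdVec_apply]
  simp only [mem_levelPEquiv, PEquiv.mem_single_iff, glue_absorb, (absorb θ K).apply_eq_iff_eq,
    Prod.mk.injEq]
  grind

theorem amplify_mul_amplify_mem_levelAlg (a : levelAlg θ K θ) (b : compactOps (EllTwo ℕ)) :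
    amplify (absorb θ K) a.1 * amplify (absorbSwap θ K) b.1 ∈ levelAlg θ K θ := by
  refine map_mem_closure₂ (f := fun a b => amplify (absorb θ K) a * amplify (absorbSwap θ K) b)
    (((continuous_amplify _).comp continuous_fst).mul
      ((continuous_amplify _).comp continuous_snd))
    (mem_levelAlg_iff.1 a.2) (mem_closure_span_matrixUnit b.2) ?_
  intro x hx y hy
  change amplify (absorb θ K) x * amplify (absorbSwap θ K) y ∈ levelSpan θ K θ
  induction hx using Submodule.span_induction with
  | mem x hx =>
    obtain ⟨o, s, t, ho, rfl⟩ := hx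
    induction hy using Submodule.span_induction with
    | mem y hy =>
      obtain ⟨k, l, rfl⟩ := hy
      rw [amplify_levelUnit_mul_matrixUnit]
      exact Submodule.subset_span ⟨o, _, _, ho, rfl⟩
    | zero => rw [map_zero, mul_zero]; exact zero_mem _
    | add y z _ _ hy hz => rw [map_add, mul_add]; exact add_mem hy hz
    | smul c y _ hy => rw [map_smul, mul_smul_comm]; exact SMulMemClass.smul_mem _ hy
  | zero => rw [map_zero, zero_mul]; exact zero_mem _
  | add x z _ _ hx hz => rw [map_add, add_mul]; exact add_mem hx hz
  | smul c x _ hx => rw [map_smul, smul_mul_assoc]; exact SMulMemClass.smul_mem _ hx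

/-- The bilinear map exhibiting the level algebra as its own tensor product with the compacts. -/
def tensorMap (θ : Ordinal.{u}) (K : Type u) [Zero K] :
    levelAlg θ K θ →ₗ[ℂ] compactOps (EllTwo ℕ) →ₗ[ℂ] levelAlg θ K θ :=
  LinearMap.mk₂ ℂ (fun a b => ⟨amplify (absorb θ K) a.1 * amplify (absorbSwap θ K) b.1,
      amplify_mul_amplify_mem_levelAlg a b⟩)
    (fun a a' b => Subtype.ext (by
      change amplify (absorb θ K) (a.1 + a'.1) * _ = _ + _
      rw [map_add, add_mul]))
    (fun c a b => Subtype.ext (by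
      change amplify (absorb θ K) (c • a.1) * _ = c • (_ * _)
      rw [map_smul, smul_mul_assoc]))
    (fun a b b' => Subtype.ext (by
      change _ * amplify (absorbSwap θ K) (b.1 + b'.1) = _ + _
      rw [map_add, mul_add]))
    (fun c a b => Subtype.ext (by
      change _ * amplify (absorbSwap θ K) (c • b.1) = c • (_ * _)
      rw [map_smul, mul_smul_comm]))

theorem coe_tensorMap (a : levelAlg θ K θ) (b : compactOps (EllTwo ℕ)) :
    (tensorMap θ K a b).1 = amplify (absorb θ K) a.1 * amplify (absorbSwap θ K) b.1 := rfl

theorem tensorMap_mul (a a' : levelAlg θ K θ) (b b' : compactOps (EllTwo ℕ)) :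
    tensorMap θ K (a * a') (b * b') = tensorMap θ K a b * tensorMap θ K a' b' := by
  refine Subtype.ext ?_
  change amplify (absorb θ K) (a.1 * a'.1) * amplify (absorbSwap θ K) (b.1 * b'.1) =
    (amplify (absorb θ K) a.1 * amplify (absorbSwap θ K) b.1) *
      (amplify (absorb θ K) a'.1 * amplify (absorbSwap θ K) b'.1)
  rw [map_mul, map_mul, mul_assoc, mul_assoc, ← mul_assoc (amplify (absorb θ K) a'.1),
    amplify_absorb_comm a'.1 b.1, mul_assoc]

theorem tensorMap_star (a : levelAlg θ K θ) (b : compactOps (EllTwo ℕ)) :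
    tensorMap θ K (star a) (star b) = star (tensorMap θ K a b) := by
  refine Subtype.ext ?_
  change amplify (absorb θ K) (star a.1) * amplify (absorbSwap θ K) (star b.1) =
    star (amplify (absorb θ K) a.1 * amplify (absorbSwap θ K) b.1)
  rw [map_star, map_star, amplify_absorb_comm a.1 b.1, star_mul]

/-- A bilinear map that multiplies the values of separating families of functionals is injective
on the tensor product. -/
theorem lift_injective_of_functionals {A : Type u} {B : Type v} {C : Type w} [AddCommGroup A]
    [Module ℂ A] [AddCommGroup B] [Module ℂ B] [AddCommGroup C] [Module ℂ C]
    (φ : A →ₗ[ℂ] B →ₗ[ℂ] C) {I J : Type*} (p : I → A →ₗ[ℂ] ℂ) (q : J → B →ₗ[ℂ] ℂ)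
    (r : I → J → C →ₗ[ℂ] ℂ) (hr : ∀ i j a b, r i j (φ a b) = p i a * q j b)
    (hp : ∀ a, (∀ i, p i a = 0) → a = 0) (hq : ∀ b, (∀ j, q j b = 0) → b = 0) :
    Function.Injective (TensorProduct.lift φ) := by
  classical
  rw [injective_iff_map_eq_zero]
  intro t ht
  -- Write the tensor as `∑ c_k ⊗ b_k` over a basis of `B`. For fixed `i`, applying every `r i j`
  -- shows that all `q j` kill `∑ p_i(c_k) b_k`, so this sum vanishes and each `p_i(c_k)` is zero.
  let ℬ := Module.Free.chooseBasis ℂ B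
  obtain ⟨c, rfl⟩ := (TensorProduct.equivFinsuppOfBasisRight (M := A) ℬ).symm.surjective t
  rw [TensorProduct.equivFinsuppOfBasisRight_symm_apply] at ht ⊢
  suffices hc : c = 0 by rw [hc, Finsupp.sum_zero_index]
  rw [Finsupp.sum, map_sum] at ht
  simp only [TensorProduct.lift.tmul] at ht
  ext1 k
  refine hp _ fun i => ?_
  have hsum : ∑ k ∈ c.support, p i (c k) • ℬ k = 0 := by
    refine hq _ fun j => ?_
    have h1 := congrArg (r i j) ht
    rw [map_sum, map_zero] at h1
    rw [map_sum, ← h1]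
    exact Finset.sum_congr rfl fun k _ => by rw [map_smul, hr, smul_eq_mul]
  by_cases hk : k ∈ c.support
  · exact linearIndependent_iff'.1 ℬ.linearIndependent c.support _ hsum k hk
  · rw [Finsupp.notMem_support_iff.1 hk, map_zero]

/-- The matrix entry at `(y, x)`, as a linear functional. -/
def entry {X : Type u} (x y : X) : (EllTwo X →L[ℂ] EllTwo X) →ₗ[ℂ] ℂ where
  toFun T := T (stdVec x) y
  map_add' _ _ := rfl
  map_smul' _ _ := rfl

theorem lift_tensorMap_injective :
    Function.Injective (TensorProduct.lift (tensorMap θ K)) :=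
  lift_injective_of_functionals (tensorMap θ K)
    (fun i : LevelIndex θ K × LevelIndex θ K =>
      entry i.1 i.2 ∘ₗ (levelAlg θ K θ).toNonUnitalSubalgebra.toSubmodule.subtype)
    (fun j : ℕ × ℕ =>
      entry j.1 j.2 ∘ₗ (compactOps (EllTwo ℕ)).toNonUnitalSubalgebra.toSubmodule.subtype)
    (fun i j => entry (absorb θ K (i.1, j.1)) (absorb θ K (i.2, j.2)) ∘ₗ
      (levelAlg θ K θ).toNonUnitalSubalgebra.toSubmodule.subtype)
    (fun i j a b => amplify_absorb_mul_apply a.1 b.1 i.1 i.2 j.1 j.2)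
    (fun _ h => Subtype.ext (clm_ext_matrix fun x y => h (x, y)))
    (fun _ h => Subtype.ext (clm_ext_matrix fun x y => h (x, y)))

/-- Every level unit is an elementary tensor, because `absorb` is surjective. -/
theorem denseRange_lift_tensorMap :
    DenseRange (TensorProduct.lift (tensorMap θ K)) := by
  intro a
  rw [Topology.IsInducing.subtypeVal.closure_eq_preimage_closure_image, Set.mem_preimage]
  refine closure_mono ?_ (mem_levelAlg_iff.1 a.2)
  intro x hx
  induction hx using Submodule.span_induction with
  | mem x hx =>
    obtain ⟨o, s, t, ho, rfl⟩ := hx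
    obtain ⟨⟨s, k⟩, rfl⟩ := (absorb θ K).surjective s
    obtain ⟨⟨t, l⟩, rfl⟩ := (absorb θ K).surjective t
    refine ⟨_, ⟨(⟨levelUnit o s t, levelUnit_mem_levelAlg ho s t⟩ : levelAlg θ K θ) ⊗ₜ[ℂ]
      (⟨matrixUnit k l, matrixUnit_mem_compactOps k l⟩ : compactOps (EllTwo ℕ)), rfl⟩, ?_⟩
    rw [TensorProduct.lift.tmul, coe_tensorMap]
    exact amplify_levelUnit_mul_matrixUnit o s t k l
  | zero => exact ⟨0, ⟨0, map_zero _⟩, rfl⟩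
  | add x y _ _ hx hy =>
    obtain ⟨_, ⟨p, rfl⟩, rfl⟩ := hx
    obtain ⟨_, ⟨q, rfl⟩, rfl⟩ := hy
    exact ⟨_, ⟨p + q, map_add _ _ _⟩, rfl⟩
  | smul c x _ hx =>
    obtain ⟨_, ⟨p, rfl⟩, rfl⟩ := hx
    exact ⟨_, ⟨c • p, map_smul _ _ _⟩, rfl⟩

theorem isStable_levelAlg : IsStable (levelAlg θ K θ) :=
  ⟨levelAlg θ K θ, inferInstance, ⟨tensorMap θ K, tensorMap_mul, tensorMap_star,
    lift_tensorMap_injective, denseRange_lift_tensorMap⟩, ⟨StarAlgEquiv.refl ℂ _⟩⟩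

end Stability

/-! ### Cardinality of the upper parts -/

section Cardinality

open Cardinal

variable {θ : Ordinal.{u}} {K : Type u} [Zero K] [Infinite K]

theorem nonempty_equiv_upperPart (hθ : #θ.ToType ≤ #K) {α : Ordinal.{u}} (hα : α < θ) :
    Nonempty (K ≃ UpperPart θ K α) := by
  obtain ⟨i, hi⟩ := exists_level_eq hα
  have : Nonempty θ.ToType := ⟨i⟩
  rw [← Cardinal.eq]
  refine le_antisymm ?_ ?_
  -- Here `level i = α`: a function supported at `i` is trivial below `α`, and its value there
  -- ranges over `K`.
  · refine Cardinal.mk_le_of_injective (f := fun k => ⟨(Finsupp.single i k, 0), ?_⟩) ?_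
    · refine levelIndex_ext (fun j => ?_) rfl
      rcases lt_or_ge (level j) α with h | h
      · rw [glue_fst_of_lt _ _ h]
        have hij : i ≠ j := by rintro rfl; exact absurd h (not_lt.2 hi.ge)
        simp [basePoint, Finsupp.single_eq_of_ne' hij]
      · rw [glue_fst_of_le _ _ h]
    · intro k l h
      have h1 := congrArg (fun p : UpperPart θ K α => p.1.1 i) h
      simpa using h1
  · calc #(UpperPart θ K α) ≤ #(LevelIndex θ K) := mk_subtype_le _
      _ = #(θ.ToType →₀ K) * ℵ₀ := by simp
      _ = max #θ.ToType #K * ℵ₀ := by rw [mk_finsupp_of_infinite']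
      _ = #K * ℵ₀ := by rw [max_eq_right hθ]
      _ = #K := mul_eq_left (aleph0_le_mk K) (aleph0_le_mk K) aleph0_ne_zero

end Cardinality

end ScatteredCStar

end

/-! ### The main theorem, with `K` of cardinality `κ`. -/

theorem mainTheorem6 (κ : Cardinal.{u}) (hκ : κ.IsRegular)
    (θ : Ordinal.{u}) (hθ : θ < (Order.succ κ).ord) :
    ∃ (A : Type u) (_ : NonUnitalCStarAlgebra A) (S : ScatteredCStar.CantorBendixson A),
      ScatteredCStar.IsScattered A ∧
      S.height = θ ∧
      (∀ α, α < S.height →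
        Nonempty (S.layer α ≃⋆ₐ[ℂ]
          ScatteredCStar.compactOps (ScatteredCStar.EllTwo κ.out))) ∧
      S.FullyNoncommutative ∧
      (θ ≠ 0 → S.IsWidth κ) ∧
      ScatteredCStar.IsStable A := by
  have hinf : Infinite κ.out :=
    Cardinal.infinite_iff.2 (by rw [Cardinal.mk_out]; exact hκ.aleph0_le)
  -- Any element of `κ.out` may serve as the zero; it only fixes what finite support means.
  let : Zero κ.out := ⟨Classical.arbitrary _⟩
  have hcard : Cardinal.mk θ.ToType ≤ Cardinal.mk κ.out := by
    rw [Cardinal.mk_toType, Cardinal.mk_out]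
    exact Order.lt_succ_iff.1 (Cardinal.lt_ord.1 hθ)
  let C := ScatteredCStar.levelSeries (θ := θ) (K := κ.out) (ι := κ.out) fun α hα =>
    (ScatteredCStar.nonempty_equiv_upperPart hcard hα).some
  have hlayer : ∀ α, α < C.cantorBendixson.height → Nonempty (C.cantorBendixson.layer α ≃⋆ₐ[ℂ]
      ScatteredCStar.compactOps (ScatteredCStar.EllTwo κ.out)) :=
    fun α hα => ⟨C.layerEquiv hα⟩
  exact ⟨ScatteredCStar.levelAlg θ κ.out θ, inferInstance, C.cantorBendixson, C.isScattered, rfl,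
    hlayer, fun α hα => ⟨_, _, _, _, hlayer α hα⟩,
    ScatteredCStar.CantorBendixson.isWidth_of_layers hκ.aleph0_le hlayer,
    ScatteredCStar.isStable_levelAlg⟩
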